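/- Let $\mathcal O_2=\mathbb C\{x,y\}$ be the ring of germs at the origin of holomorphic functions on $\mathbb C^2$. For $f,h\in\mathcal O_2$ put $m(f,h)=\dim_{\mathbb C}\mathcal O_2/\langle f,h\rangle\in\mathbb N\cup\{\infty\}$, and define $$i_f=f_y^2f_{xx}-2f_xf_yf_{xy}+f_x^2f_{yy},\qquad I_f=m(f,i_f).$$ Two germs $f,h:(\mathbb C^2,0)\to(\mathbb C,0)$ are $\mathcal K$-equivalent if $h=A\cdot(f\circ\varphi^{-1})$ for some germ of a biholomorphic map $\varphi:(\mathbb C^2,0)\to(\mathbb C^2,0)$ and some unit $A\in\mathcal O_2$. Let $f:(\mathbb C^2,0)\to(\mathbb C,0)$ be a holomorphic germ that is semi-quasihomogeneous with quasihomogeneous part $g$, of degree $d$ for the coprime positive integer weights $w_1$ of $x$ and $w_2$ of $y$. That is: $g$ is a polynomial all of whose terms have weight $d$; $g$ has finite Milnor number $m(g_x,g_y)$ at the origin; and all terms of $f-g$ have weight $>d$. Assume that $g$ is not homogeneous (in the ordinary sense) and that neither $x$ nor $y$ divides $g$. **Proposition.** Under these assumptions $$I_f=\frac{d\,(3d-2w_1-2w_2)}{w_1w_2};$$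 in particular $I_f$ is finite. If moreover neither $w_1$ nor $w_2$ equals $1$, then this is the maximum value of $I_h$ over all germs $h$ that are $\mathcal K$-equivalent to $f$. -/

import Mathlib

namespace PlaneGerm

/-- A power series in `x = X 0`, `y = X 1` over `ℂ` is convergent when it converges absolutely on
some polydisc around the origin. -/
def Converges (f : MvPowerSeries (Fin 2) ℂ) : Prop :=
  ∃ r : ℝ, 0 < r ∧ Summable fun n : Fin 2 →₀ ℕ => ‖MvPowerSeries.coeff n f‖ * r ^ n.degree

theorem Converges.of_finite {f : MvPowerSeries (Fin 2) ℂ}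
    (h : {n | MvPowerSeries.coeff n f ≠ 0}.Finite) : Converges f := by
  refine ⟨1, one_pos, summable_of_hasFiniteSupport (h.subset ?_)⟩
  intro n hn hn0
  simp [hn0] at hn

theorem Converges.coe (p : MvPolynomial (Fin 2) ℂ) :
    Converges (p : MvPowerSeries (Fin 2) ℂ) := by
  refine Converges.of_finite (p.support.finite_toSet.subset ?_)
  intro n hn
  simpa [MvPolynomial.mem_support_iff] using hn

theorem Converges.summable_le {f : MvPowerSeries (Fin 2) ℂ} {r s : ℝ} (hs : 0 < s) (hsr : s ≤ r)
    (h : Summable fun n : Fin 2 →₀ ℕ => ‖MvPowerSeries.coeff n f‖ * r ^ n.degree) :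
    Summable fun n : Fin 2 →₀ ℕ => ‖MvPowerSeries.coeff n f‖ * s ^ n.degree :=
  h.of_nonneg_of_le (fun n => by positivity) (fun n => by gcongr)

theorem Converges.add {f g : MvPowerSeries (Fin 2) ℂ} (hf : Converges f) (hg : Converges g) :
    Converges (f + g) := by
  obtain ⟨r, hr, hf⟩ := hf
  obtain ⟨s, hs, hg⟩ := hg
  have hm : 0 < min r s := lt_min hr hs
  refine ⟨min r s, hm, ((summable_le hm (min_le_left r s) hf).add
    (summable_le hm (min_le_right r s) hg)).of_nonneg_of_le (fun n => by positivity) fun n => ?_⟩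
  rw [map_add, ← add_mul]
  gcongr
  exact norm_add_le _ _

theorem summable_antidiagonal {u v : (Fin 2 →₀ ℕ) → ℝ} (hu : Summable u) (hv : Summable v)
    (hu0 : 0 ≤ u) (hv0 : 0 ≤ v) :
    Summable fun n => ∑ p ∈ Finset.HasAntidiagonal.antidiagonal n, u p.1 * v p.2 :=
  summable_sum_mul_antidiagonal_of_summable_mul (hu.mul_of_nonneg hv hu0 hv0)

theorem norm_coeff_mul_le (f g : MvPowerSeries (Fin 2) ℂ) {t : ℝ} (ht : 0 < t) (n : Fin 2 →₀ ℕ) :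
    ‖MvPowerSeries.coeff n (f * g)‖ * t ^ n.degree ≤
      ∑ p ∈ Finset.HasAntidiagonal.antidiagonal n,
        (‖MvPowerSeries.coeff p.1 f‖ * t ^ p.1.degree) *
          (‖MvPowerSeries.coeff p.2 g‖ * t ^ p.2.degree) := by
  rw [MvPowerSeries.coeff_mul]
  refine (mul_le_mul_of_nonneg_right (norm_sum_le _ _) (pow_nonneg ht.le _)).trans ?_
  rw [Finset.sum_mul]
  refine Finset.sum_le_sum fun p hp => le_of_eq ?_
  rw [← Finset.HasAntidiagonal.mem_antidiagonal.1 hp, map_add, pow_add, norm_mul]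
  ring

theorem Converges.mul {f g : MvPowerSeries (Fin 2) ℂ} (hf : Converges f) (hg : Converges g) :
    Converges (f * g) := by
  obtain ⟨r, hr, hf⟩ := hf
  obtain ⟨s, hs, hg⟩ := hg
  have hm : 0 < min r s := lt_min hr hs
  have h1 := summable_le hm (min_le_left r s) hf
  have h2 := summable_le hm (min_le_right r s) hg
  have h0 : ∀ h : MvPowerSeries (Fin 2) ℂ, (0 : (Fin 2 →₀ ℕ) → ℝ) ≤
      fun n => ‖MvPowerSeries.coeff n h‖ * (min r s) ^ n.degree :=
    fun h n => mul_nonneg (norm_nonneg _) (pow_nonneg hm.le _)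
  have h3 := summable_antidiagonal h1 h2 (h0 f) (h0 g)
  have h4 : Summable fun n : Fin 2 →₀ ℕ =>
      ‖MvPowerSeries.coeff n (f * g)‖ * (min r s) ^ n.degree :=
    h3.of_nonneg_of_le (h0 (f * g)) (norm_coeff_mul_le f g hm)
  exact ⟨min r s, hm, h4⟩

theorem Converges.pderiv {f : MvPowerSeries (Fin 2) ℂ} (hf : Converges f) (i : Fin 2) :
    Converges (MvPowerSeries.pderiv ℂ i f) := by
  obtain ⟨r, hr, hf⟩ := hf
  refine ⟨r / 2, by positivity, ?_⟩
  have hinj : Function.Injective fun n : Fin 2 →₀ ℕ => n + Finsupp.single i 1 :=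
    add_left_injective _
  have h := (hf.comp_injective hinj).mul_left r⁻¹
  refine h.of_nonneg_of_le (fun n => by positivity) fun n => ?_
  have hn : ((n i : ℝ) + 1) ≤ 2 ^ n.degree := by
    have h1 : n i ≤ n.degree := Finsupp.le_degree i n
    have h2 : n.degree + 1 ≤ 2 ^ n.degree := Nat.lt_two_pow_self
    exact_mod_cast (Nat.succ_le_succ h1).trans h2
  have hnorm : ‖((n i : ℂ) + 1)‖ = (n i : ℝ) + 1 := by
    exact_mod_cast Complex.norm_natCast (n i + 1)
  rw [MvPowerSeries.coeff_pderiv, norm_mul, hnorm]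
  simp only [Function.comp_apply, map_add, Finsupp.degree_single]
  have e : r⁻¹ * (‖MvPowerSeries.coeff (n + Finsupp.single i 1) f‖ * r ^ (n.degree + 1))
      = ‖MvPowerSeries.coeff (n + Finsupp.single i 1) f‖ * 2 ^ n.degree * (r / 2) ^ n.degree := by
    rw [div_pow, pow_succ]
    field_simp
  rw [e]
  gcongr

/-- The ring `𝒪₂ = ℂ{x, y}` of germs at the origin of holomorphic functions on `ℂ²`, each germ
being given by its (convergent) Taylor series. -/
def O2 : Subalgebra ℂ (MvPowerSeries (Fin 2) ℂ) where
  carrier := {f | Converges f}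
  mul_mem' := Converges.mul
  add_mem' := Converges.add
  algebraMap_mem' c := by
    have h := Converges.coe (MvPolynomial.C c)
    rwa [MvPolynomial.coe_C] at h

/-- The germ at the origin of a polynomial. -/
noncomputable def ofPoly (p : MvPolynomial (Fin 2) ℂ) : O2 :=
  ⟨(p : MvPowerSeries (Fin 2) ℂ), Converges.coe p⟩

/-- Partial derivatives of germs; `pd 0` is `∂/∂x` and `pd 1` is `∂/∂y`. -/
noncomputable def pd (i : Fin 2) (f : O2) : O2 :=
  ⟨MvPowerSeries.pderiv ℂ i (f : MvPowerSeries (Fin 2) ℂ), Converges.pderiv f.2 i⟩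

/-- The intersection number `m(f, g) = dim_ℂ 𝒪₂ / ⟨f, g⟩`, with value `⊤` when the dimension is
infinite. -/
noncomputable def intersectionNumber (f g : O2) : ℕ∞ :=
  Cardinal.toENat (Module.rank ℂ (O2 ⧸ Ideal.span {f, g}))

/-- The Milnor number `μ(f) = m(f_x, f_y)`. -/
noncomputable def milnorNumber (f : O2) : ℕ∞ :=
  intersectionNumber (pd 0 f) (pd 1 f)

/-- `i_f = f_y² f_xx - 2 f_x f_y f_xy + f_x² f_yy`. -/
noncomputable def inflectionGerm (f : O2) : O2 :=
  pd 1 f ^ 2 * pd 0 (pd 0 f) - 2 * pd 0 f * pd 1 f * pd 1 (pd 0 f) + pd 0 f ^ 2 * pd 1 (pd 1 f)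

/-- `I_f = m(f, i_f)`: the number of inflections of `f = 0` concentrated at the origin. -/
noncomputable def inflectionNumber (f : O2) : ℕ∞ :=
  intersectionNumber f (inflectionGerm f)

/-- `φ = (φ 0, φ 1)` and `ψ = (ψ 0, ψ 1)` are mutually inverse germs of biholomorphic maps
`(ℂ², 0) → (ℂ², 0)`. -/
structure IsInversePair (φ ψ : Fin 2 → O2) : Prop where
  zero_left : ∀ i, MvPowerSeries.constantCoeff (φ i : MvPowerSeries (Fin 2) ℂ) = 0
  zero_right : ∀ i, MvPowerSeries.constantCoeff (ψ i : MvPowerSeries (Fin 2) ℂ) = 0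
  left_inv : ∀ i, MvPowerSeries.subst (fun j => (φ j : MvPowerSeries (Fin 2) ℂ))
    (ψ i : MvPowerSeries (Fin 2) ℂ) = MvPowerSeries.X i
  right_inv : ∀ i, MvPowerSeries.subst (fun j => (ψ j : MvPowerSeries (Fin 2) ℂ))
    (φ i : MvPowerSeries (Fin 2) ℂ) = MvPowerSeries.X i

/-- `h` is `𝒦`-equivalent to `f`: `h = A · (f ∘ φ⁻¹)` for a germ of a biholomorphic map
`φ : (ℂ², 0) → (ℂ², 0)`, with inverse `ψ`, and a germ `A : (ℂ², 0) → GL(1, ℂ)`, that is, a unit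
of `𝒪₂`. -/
def KEquivalent (f h : O2) : Prop :=
  ∃ (φ ψ : Fin 2 → O2) (A : O2ˣ), IsInversePair φ ψ ∧
    (h : MvPowerSeries (Fin 2) ℂ) = ((A : O2) : MvPowerSeries (Fin 2) ℂ) *
      MvPowerSeries.subst (fun j => (ψ j : MvPowerSeries (Fin 2) ℂ))
        (f : MvPowerSeries (Fin 2) ℂ)

/-- `f` is semi-quasihomogeneous with quasihomogeneous part `g`, of degree `d` for the coprime
positive weights `w 0` of `x` and `w 1` of `y`: the polynomial `g` is quasihomogeneous of degree
`d` and nondegenerate (of finite Milnor number at the origin), and every term of `f - g` has weight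
greater than `d`. -/
structure IsSemiQuasihomogeneous (w : Fin 2 → ℕ) (d : ℕ) (g : MvPolynomial (Fin 2) ℂ) (f : O2) :
    Prop where
  weight_pos : ∀ i, 0 < w i
  coprime : Nat.Coprime (w 0) (w 1)
  quasihomogeneous : g.IsWeightedHomogeneous w d
  nondegenerate : milnorNumber (ofPoly g) ≠ ⊤
  higher_weight : ∀ n : Fin 2 →₀ ℕ,
    MvPowerSeries.coeff n ((f - ofPoly g : O2) : MvPowerSeries (Fin 2) ℂ) ≠ 0 →
      d < Finsupp.weight w n

end PlaneGerm

namespace PlaneGerm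

open MvPowerSeries

/-! Since neither variable divides `g`, the form `g` contains a pure power of each variable, so both
weights divide `d`. They are coprime, hence d = k w₀w₁. The initial form of i_f is i_g, of weight e
= 3d − 2w₀ − 2w₁, and weighted Bézout (`HasInitialForm.finrank_quotient_span_pair`) gives I_f =
de/(w₀w₁) = ke as soon as i_g is a non-zero-divisor modulo g. That follows from the congruence w₀²x²
i_g ≡ w₁(w₀ − w₁) y g_y³ mod g (`IsWeightForm.dvd_sub_hessianForm`), a consequence of Euler's
relations: y is prime to g, g_y is prime to g by finiteness of the Milnor number, and w₀ ≠ w₁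
because g is not homogeneous.

Bézout itself is a count of monomials. Modulo f and all terms of weight ≥ N the dimension is a
lattice-point count, which grows by exactly k with each unit of N beyond d. Multiplication by h
shifts N by e (`HasInitialForm.mul_mem_sup_iff`), so dividing by h as well leaves ke, independently
of N. Nakayama's lemma then removes the truncation, and a second use of it passes from formal to
convergent series.

For maximality, multiplying f by a unit does not change the ideal ⟨f, i_f⟩, while a change of
coordinates replaces i_f by a unit times i_f plus a cubic form in f_x, f_y with arbitrary
coefficients. If w_i < w_j, only the term c₀ f_j³ can have weight as low as i_f
(`HasInitialForm.finrank_quotient_add_cubic_le`). Either c₀ has weight above w_j − 2w_i and the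
number is unchanged, or c₀ starts with γx_i^m of smaller weight and the number drops. A tie would
require w_i ∣ w_j, which is impossible for coprime weights different from 1. -/

/-! ### Weight filtration and initial forms. -/

/-- The ideal of power series all of whose terms have weight at least `N`. -/
def weightIdeal (w : Fin 2 → ℕ) (N : ℤ) : Ideal (MvPowerSeries (Fin 2) ℂ) where
  carrier := {f | ∀ n, coeff n f ≠ 0 → N ≤ (Finsupp.weight w n : ℕ)}
  zero_mem' := fun n hn => absurd (coeff_zero n) hn
  add_mem' := by
    intro f g hf hg n hn
    by_cases h : coeff n f = 0
    · exact hg n (by simpa [h] using hn)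
    · exact hf n h
  smul_mem' := by
    intro c f hf n hn
    rw [smul_eq_mul, coeff_mul] at hn
    obtain ⟨p, hp, hpn⟩ := Finset.exists_ne_zero_of_sum_ne_zero hn
    have h := hf p.2 (right_ne_zero_of_mul hpn)
    rw [← Finset.HasAntidiagonal.mem_antidiagonal.1 hp, map_add]
    push_cast
    omega

theorem mem_weightIdeal {w : Fin 2 → ℕ} {N : ℤ} {f : MvPowerSeries (Fin 2) ℂ} :
    f ∈ weightIdeal w N ↔ ∀ n, coeff n f ≠ 0 → N ≤ (Finsupp.weight w n : ℕ) := Iff.rfl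

theorem weightIdeal_anti {w : Fin 2 → ℕ} {M N : ℤ} (h : M ≤ N) :
    weightIdeal w N ≤ weightIdeal w M := fun _ hf n hn => h.trans (hf n hn)

/-- Weight bounds are integers so that differences such as N − d are not truncated. This case covers
the negative ones and starts the inductions on weight. -/
theorem weightIdeal_of_nonpos {w : Fin 2 → ℕ} {N : ℤ} (h : N ≤ 0) : weightIdeal w N = ⊤ := by
  rw [Ideal.eq_top_iff_one]
  exact fun n _ => h.trans (Int.natCast_nonneg _)

theorem mul_mem_weightIdeal {w : Fin 2 → ℕ} {M N : ℤ} {f g : MvPowerSeries (Fin 2) ℂ}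
    (hf : f ∈ weightIdeal w M) (hg : g ∈ weightIdeal w N) : f * g ∈ weightIdeal w (M + N) := by
  intro n hn
  rw [coeff_mul] at hn
  obtain ⟨p, hp, hpn⟩ := Finset.exists_ne_zero_of_sum_ne_zero hn
  have h1 := hf p.1 (left_ne_zero_of_mul hpn)
  have h2 := hg p.2 (right_ne_zero_of_mul hpn)
  rw [← Finset.HasAntidiagonal.mem_antidiagonal.1 hp, map_add]
  push_cast
  omega

theorem weight_add_single (w : Fin 2 → ℕ) (n : Fin 2 →₀ ℕ) (i : Fin 2) :
    Finsupp.weight w (n + Finsupp.single i 1) = Finsupp.weight w n + w i := by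
  rw [map_add, Finsupp.weight_single, one_smul]

theorem pderiv_mem_weightIdeal {w : Fin 2 → ℕ} {N : ℤ} {f : MvPowerSeries (Fin 2) ℂ} (i : Fin 2)
    (hf : f ∈ weightIdeal w N) : pderiv ℂ i f ∈ weightIdeal w (N - w i) := by
  intro n hn
  rw [coeff_pderiv] at hn
  have h := hf _ (left_ne_zero_of_mul hn)
  rw [weight_add_single] at h
  push_cast at h
  omega

/-- A power series all of whose terms have weight `e`. -/
def IsWeightForm (w : Fin 2 → ℕ) (e : ℤ) (q : MvPowerSeries (Fin 2) ℂ) : Prop :=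
  ∀ n, coeff n q ≠ 0 → (Finsupp.weight w n : ℕ) = e

namespace IsWeightForm

variable {w : Fin 2 → ℕ} {d e : ℤ} {p q : MvPowerSeries (Fin 2) ℂ}

theorem mem_weightIdeal (h : IsWeightForm w e q) : q ∈ weightIdeal w e :=
  fun n hn => (h n hn).ge

theorem eq_zero (h : IsWeightForm w e q) (hq : q ∈ weightIdeal w (e + 1)) : q = 0 := by
  ext n
  by_contra hn
  have h1 := h n hn
  have h2 := hq n hn
  omega

theorem add (hp : IsWeightForm w e p) (hq : IsWeightForm w e q) : IsWeightForm w e (p + q) := by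
  intro n hn
  by_cases h : coeff n p = 0
  · exact hq n (by simpa [h] using hn)
  · exact hp n h

theorem neg (hp : IsWeightForm w e p) : IsWeightForm w e (-p) :=
  fun n hn => hp n (by simpa using hn)

theorem sub (hp : IsWeightForm w e p) (hq : IsWeightForm w e q) : IsWeightForm w e (p - q) := by
  rw [sub_eq_add_neg]
  exact hp.add hq.neg

theorem mul (hp : IsWeightForm w d p) (hq : IsWeightForm w e q) :
    IsWeightForm w (d + e) (p * q) := by
  intro n hn
  rw [coeff_mul] at hn
  obtain ⟨m, hm, hmn⟩ := Finset.exists_ne_zero_of_sum_ne_zero hn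
  have h1 := hp m.1 (left_ne_zero_of_mul hmn)
  have h2 := hq m.2 (right_ne_zero_of_mul hmn)
  rw [← Finset.HasAntidiagonal.mem_antidiagonal.1 hm, map_add]
  push_cast
  omega

theorem const (c : ℂ) : IsWeightForm w 0 (C c) := by
  classical
  intro n hn
  rw [coeff_C] at hn
  have : n = 0 := by by_contra h; simp [h] at hn
  simp [this]

theorem var (i : Fin 2) : IsWeightForm w (w i) (X i) := by
  classical
  intro n hn
  rw [coeff_X] at hn
  have : n = Finsupp.single i 1 := by by_contra h; simp [h] at hn
  rw [this, Finsupp.weight_single, one_smul]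

theorem pow (hp : IsWeightForm w e p) (m : ℕ) : IsWeightForm w (m * e) (p ^ m) := by
  induction m with
  | zero => simpa using const (w := w) 1
  | succ m ih => rw [pow_succ]; convert ih.mul hp using 1; push_cast; ring

theorem pderiv (hp : IsWeightForm w e p) (i : Fin 2) :
    IsWeightForm w (e - w i) (MvPowerSeries.pderiv ℂ i p) := by
  intro n hn
  rw [coeff_pderiv] at hn
  have h := hp _ (left_ne_zero_of_mul hn)
  rw [weight_add_single] at h
  push_cast at h
  omega

end IsWeightForm

/-- The part of weight `e` of a power series. -/
noncomputable def weightPart (w : Fin 2 → ℕ) (e : ℤ) (f : MvPowerSeries (Fin 2) ℂ) :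
    MvPowerSeries (Fin 2) ℂ :=
  fun n => if ((Finsupp.weight w n : ℕ) : ℤ) = e then coeff n f else 0

theorem coeff_weightPart (w : Fin 2 → ℕ) (e : ℤ) (f : MvPowerSeries (Fin 2) ℂ) (n : Fin 2 →₀ ℕ) :
    coeff n (weightPart w e f) = if ((Finsupp.weight w n : ℕ) : ℤ) = e then coeff n f else 0 := rfl

theorem isWeightForm_weightPart (w : Fin 2 → ℕ) (e : ℤ) (f : MvPowerSeries (Fin 2) ℂ) :
    IsWeightForm w e (weightPart w e f) := by
  intro n hn
  rw [coeff_weightPart] at hn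
  by_contra h
  simp [h] at hn

theorem sub_weightPart_mem {w : Fin 2 → ℕ} {e : ℤ} {f : MvPowerSeries (Fin 2) ℂ}
    (hf : f ∈ weightIdeal w e) : f - weightPart w e f ∈ weightIdeal w (e + 1) := by
  intro n hn
  rw [map_sub, coeff_weightPart] at hn
  split_ifs at hn with h
  · simp at hn
  · have := hf n (by simpa using hn)
    omega

theorem IsWeightForm.weightPart_mul {w : Fin 2 → ℕ} {d : ℤ} {g : MvPowerSeries (Fin 2) ℂ}
    (hg : IsWeightForm w d g) (e : ℤ) (b : MvPowerSeries (Fin 2) ℂ) :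
    weightPart w e (g * b) = g * weightPart w (e - d) b := by
  ext n
  rw [coeff_weightPart, coeff_mul, coeff_mul]
  have key : ∀ p ∈ Finset.HasAntidiagonal.antidiagonal n, coeff p.1 g * coeff p.2 (weightPart w (e - d) b) =
      if ((Finsupp.weight w n : ℕ) : ℤ) = e then coeff p.1 g * coeff p.2 b else 0 := by
    intro p hp
    by_cases h0 : coeff p.1 g = 0
    · simp [h0]
    have h1 := hg _ h0
    rw [coeff_weightPart, ← Finset.HasAntidiagonal.mem_antidiagonal.1 hp, map_add]
    push_cast
    by_cases h2 : ((Finsupp.weight w p.2 : ℕ) : ℤ) = e - d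
    · rw [if_pos h2, if_pos (by omega)]
    · rw [if_neg h2, if_neg (by omega), mul_zero]
  rw [Finset.sum_congr rfl key]
  split_ifs <;> simp

theorem IsWeightForm.weightPart_eq {w : Fin 2 → ℕ} {d : ℤ} {g : MvPowerSeries (Fin 2) ℂ}
    (hg : IsWeightForm w d g) : weightPart w d g = g := by
  ext n
  rw [coeff_weightPart]
  split_ifs with h
  · rfl
  · by_contra h1
    exact h (hg n (Ne.symm h1))

/-- `q` is the initial form of `f`, of weight `e` (the case `q = 0` is allowed). -/
def HasInitialForm (w : Fin 2 → ℕ) (e : ℤ) (f q : MvPowerSeries (Fin 2) ℂ) : Prop :=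
  IsWeightForm w e q ∧ f - q ∈ weightIdeal w (e + 1)

theorem hasInitialForm_weightPart {w : Fin 2 → ℕ} {e : ℤ} {f : MvPowerSeries (Fin 2) ℂ}
    (hf : f ∈ weightIdeal w e) : HasInitialForm w e f (weightPart w e f) :=
  ⟨isWeightForm_weightPart w e f, sub_weightPart_mem hf⟩

namespace HasInitialForm

variable {w : Fin 2 → ℕ} {d e : ℤ} {f h p q : MvPowerSeries (Fin 2) ℂ}

theorem mem (hf : HasInitialForm w e f q) : f ∈ weightIdeal w e := by
  rw [← sub_add_cancel f q]
  exact add_mem (weightIdeal_anti (by omega) hf.2) hf.1.mem_weightIdeal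

theorem add (hf : HasInitialForm w e f p) (hh : HasInitialForm w e h q) :
    HasInitialForm w e (f + h) (p + q) :=
  ⟨hf.1.add hh.1, by rw [add_sub_add_comm]; exact add_mem hf.2 hh.2⟩

theorem sub (hf : HasInitialForm w e f p) (hh : HasInitialForm w e h q) :
    HasInitialForm w e (f - h) (p - q) :=
  ⟨hf.1.sub hh.1, by rw [sub_sub_sub_comm]; exact sub_mem hf.2 hh.2⟩

theorem add_mem_weightIdeal (hf : HasInitialForm w e f p) (hh : h ∈ weightIdeal w (e + 1)) :
    HasInitialForm w e (f + h) p :=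
  ⟨hf.1, by rw [add_sub_right_comm]; exact add_mem hf.2 hh⟩

theorem mul (hf : HasInitialForm w d f p) (hh : HasInitialForm w e h q) :
    HasInitialForm w (d + e) (f * h) (p * q) := by
  refine ⟨hf.1.mul hh.1, ?_⟩
  have e1 : f * h - p * q = (f - p) * h + p * (h - q) := by ring
  rw [e1]
  refine add_mem ?_ ?_
  · exact weightIdeal_anti (by omega) (mul_mem_weightIdeal hf.2 hh.mem)
  · exact weightIdeal_anti (by omega) (mul_mem_weightIdeal hf.1.mem_weightIdeal hh.2)

theorem of_isWeightForm (hq : IsWeightForm w e q) : HasInitialForm w e q q :=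
  ⟨hq, by simp⟩

theorem pow (hf : HasInitialForm w e f p) (m : ℕ) : HasInitialForm w (m * e) (f ^ m) (p ^ m) := by
  induction m with
  | zero => simpa using of_isWeightForm (IsWeightForm.const (w := w) 1)
  | succ m ih => rw [pow_succ, pow_succ]; convert ih.mul hf using 1; push_cast; ring

theorem pderiv (hf : HasInitialForm w e f p) (i : Fin 2) :
    HasInitialForm w (e - w i) (MvPowerSeries.pderiv ℂ i f) (MvPowerSeries.pderiv ℂ i p) := by
  refine ⟨hf.1.pderiv i, ?_⟩
  rw [← map_sub]
  exact weightIdeal_anti (by omega) (pderiv_mem_weightIdeal i hf.2)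

/-- As zero initial forms are allowed, cancellation in lowest weight shows up as the vanishing of
the form. -/
theorem eq_zero (hf : HasInitialForm w e f p) (h0 : f ∈ weightIdeal w (e + 1)) : p = 0 := by
  refine hf.1.eq_zero ?_
  have := sub_mem h0 hf.2
  rwa [sub_sub_cancel] at this

theorem congr (hf : HasInitialForm w e f p) (hfh : f - h ∈ weightIdeal w (e + 1)) :
    HasInitialForm w e h p :=
  ⟨hf.1, by have := sub_mem hf.2 hfh; rwa [show f - p - (f - h) = h - p by ring] at this⟩

theorem unique (hf : HasInitialForm w e f p) (hq : HasInitialForm w e f q) : p = q := by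
  have := (hf.sub hq).eq_zero (by simp)
  exact sub_eq_zero.1 this

end HasInitialForm

/-! ### Euler's relation and mixed derivatives. -/

theorem coeff_X_mul_pderiv (i : Fin 2) (f : MvPowerSeries (Fin 2) ℂ) (n : Fin 2 →₀ ℕ) :
    coeff n (X i * pderiv ℂ i f) = n i * coeff n f := by
  rw [X_def, coeff_monomial_mul]
  split_ifs with h
  · have h1 : 1 ≤ n i := by simpa using h
    rw [coeff_pderiv, tsub_add_cancel_of_le h]
    simp only [Finsupp.coe_tsub, Pi.sub_apply, Finsupp.single_eq_same, one_mul]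
    push_cast [h1]
    ring
  · have h1 : n i = 0 := by
      by_contra h2
      exact h (by simpa using Nat.one_le_iff_ne_zero.2 h2)
    simp [h1]

theorem weight_fin_two (w : Fin 2 → ℕ) (n : Fin 2 →₀ ℕ) {i j : Fin 2} (hij : i ≠ j) :
    Finsupp.weight w n = n i * w i + n j * w j := by
  rw [Finsupp.weight_apply, Finsupp.sum_fintype _ _ (by simp), Fin.sum_univ_two]
  fin_cases i <;> fin_cases j <;> simp_all [add_comm]

theorem IsWeightForm.euler {w : Fin 2 → ℕ} {e : ℤ} {q : MvPowerSeries (Fin 2) ℂ}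
    (hq : IsWeightForm w e q) {i j : Fin 2} (hij : i ≠ j) :
    C (w i : ℂ) * (MvPowerSeries.X i * MvPowerSeries.pderiv ℂ i q) +
      C (w j : ℂ) * (MvPowerSeries.X j * MvPowerSeries.pderiv ℂ j q) = C (e : ℂ) * q := by
  ext n
  rw [map_add, coeff_C_mul, coeff_C_mul, coeff_C_mul, coeff_X_mul_pderiv, coeff_X_mul_pderiv]
  by_cases h0 : coeff n q = 0
  · simp [h0]
  · rw [← hq n h0, weight_fin_two w n hij]
    push_cast
    ring

theorem pderiv_comm (i j : Fin 2) (f : MvPowerSeries (Fin 2) ℂ) :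
    pderiv ℂ i (pderiv ℂ j f) = pderiv ℂ j (pderiv ℂ i f) := by
  ext n
  by_cases hij : i = j
  · rw [hij]
  · simp only [coeff_pderiv, Finsupp.coe_add, Pi.add_apply,
      Finsupp.single_eq_of_ne hij, Finsupp.single_eq_of_ne (Ne.symm hij)]
    rw [add_right_comm n]
    ring_nf

/-! ### Non-zero-divisors modulo a form. -/

/-- `q` is a non-zero-divisor modulo `g`. -/
def IsRegularMod (g q : MvPowerSeries (Fin 2) ℂ) : Prop :=
  ∀ a, g ∣ q * a → g ∣ a

namespace IsRegularMod

variable {g p q : MvPowerSeries (Fin 2) ℂ}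

theorem mul (hp : IsRegularMod g p) (hq : IsRegularMod g q) : IsRegularMod g (p * q) :=
  fun a h => hq a (hp _ (by rwa [← mul_assoc]))

theorem pow (hp : IsRegularMod g p) (m : ℕ) : IsRegularMod g (p ^ m) := by
  induction m with
  | zero => intro a h; simpa using h
  | succ m ih => rw [pow_succ]; exact ih.mul hp

theorem of_isUnit (hp : IsUnit p) : IsRegularMod g p :=
  fun _ h => (hp.dvd_mul_left).1 h

theorem of_dvd (hp : IsRegularMod g p) (h : q ∣ p) : IsRegularMod g q := by
  obtain ⟨c, rfl⟩ := h
  intro a ha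
  exact hp a (by rw [mul_right_comm]; exact ha.mul_right c)

theorem of_dvd_sub (hp : IsRegularMod g p) (h : g ∣ p - q) : IsRegularMod g q := by
  intro a ha
  refine hp a ?_
  have := (h.mul_right a).add ha
  rwa [sub_mul, sub_add_cancel] at this

end IsRegularMod

theorem isUnit_C {c : ℂ} (hc : c ≠ 0) : IsUnit (C c : MvPowerSeries (Fin 2) ℂ) :=
  (isUnit_iff_ne_zero.2 hc).map C

theorem isUnit_of_constantCoeff_ne_zero {f : MvPowerSeries (Fin 2) ℂ} (hf : constantCoeff f ≠ 0) :
    IsUnit f :=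
  isUnit_iff_constantCoeff.2 (isUnit_iff_ne_zero.2 hf)

/-- With weight 1 on x_i and 0 on the other variable, the weight of a monomial is its exponent of
x_i. Divisibility becomes a statement about an order that is additive on products, which makes x_i
prime. -/
theorem X_dvd_iff_weightedOrder (i : Fin 2) (f : MvPowerSeries (Fin 2) ℂ) :
    X i ∣ f ↔ 1 ≤ weightedOrder (Pi.single i 1) f := by
  obtain ⟨j, hij⟩ : ∃ j, i ≠ j := ⟨1 - i, by fin_cases i <;> decide⟩
  have hw : ∀ n : Fin 2 →₀ ℕ, Finsupp.weight (Pi.single i 1 : Fin 2 → ℕ) n = n i := by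
    intro n
    simp [weight_fin_two _ n hij, Pi.single_eq_of_ne hij.symm]
  rw [X_dvd_iff]
  constructor
  · intro h
    refine le_weightedOrder _ fun n hn => h n ?_
    rw [hw] at hn
    have : n i < 1 := by exact_mod_cast hn
    omega
  · intro h n hn
    refine coeff_eq_zero_of_lt_weightedOrder (Pi.single i 1) (lt_of_lt_of_le ?_ h)
    rw [hw, hn]
    simp

theorem isRegularMod_X {i : Fin 2} {g : MvPowerSeries (Fin 2) ℂ} (hg : ¬ X i ∣ g) :
    IsRegularMod g (X i) := by
  rintro a ⟨b, hb⟩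
  have h : X i ∣ b := by
    have h1 : X i ∣ g * b := ⟨a, hb.symm⟩
    rw [X_dvd_iff_weightedOrder] at h1 hg ⊢
    rw [weightedOrder_mul] at h1
    rw [not_le, Order.lt_one_iff] at hg
    rwa [hg, zero_add] at h1
  obtain ⟨c, rfl⟩ := h
  refine ⟨c, ?_⟩
  have hX : (X i : MvPowerSeries (Fin 2) ℂ) ≠ 0 :=
    nonZeroDivisors.ne_zero X_mem_nonzeroDivisors
  exact mul_left_cancel₀ hX (by rw [hb]; ring)

/-- In a finite-dimensional quotient x_i satisfies a nonzero polynomial p. Write p = T^m q with q(0)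
≠ 0; then q(x_i) is a unit, so x_i^m already lies in the ideal. -/
theorem exists_X_pow_mem_span_of_intersectionNumber_ne_top {f h : O2}
    (hfh : intersectionNumber f h ≠ ⊤) (i : Fin 2) :
    ∃ N, (X i : MvPowerSeries (Fin 2) ℂ) ^ N ∈
      Ideal.span {(f : MvPowerSeries (Fin 2) ℂ), (h : MvPowerSeries (Fin 2) ℂ)} := by
  have hfin : Module.Finite ℂ (O2 ⧸ Ideal.span {f, h}) := by
    have : Module.Free ℂ (O2 ⧸ Ideal.span {f, h}) := Module.Free.of_divisionRing _ _
    rw [← Module.rank_lt_aleph0_iff]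
    by_contra hc
    exact hfh (Cardinal.toENat_eq_top.2 (not_lt.1 hc))
  let x : O2 := ofPoly (MvPolynomial.X i)
  obtain ⟨p, hp, hpx⟩ := Algebra.IsIntegral.isIntegral (R := ℂ)
    (Ideal.Quotient.mkₐ ℂ (Ideal.span {f, h}) x)
  have h1 : Polynomial.aeval x p ∈ Ideal.span {f, h} := by
    rw [← Ideal.Quotient.eq_zero_iff_mem]
    rw [← Polynomial.aeval_def, Polynomial.aeval_algHom_apply] at hpx
    exact hpx
  have h2 : Polynomial.aeval (X i : MvPowerSeries (Fin 2) ℂ) p ∈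
      Ideal.span {(f : MvPowerSeries (Fin 2) ℂ), (h : MvPowerSeries (Fin 2) ℂ)} := by
    have h3 := Ideal.mem_map_of_mem O2.val h1
    rw [Ideal.map_span, Set.image_pair, ← Polynomial.aeval_algHom_apply] at h3
    have h4 : O2.val x = X i := MvPolynomial.coe_X i
    rwa [h4] at h3
  obtain ⟨q, hq, hq0⟩ := Polynomial.exists_eq_pow_rootMultiplicity_mul_and_not_dvd p hp.ne_zero 0
  refine ⟨p.rootMultiplicity 0, ?_⟩
  rw [hq, map_mul, map_pow, map_sub, Polynomial.aeval_X, Polynomial.C_0, map_zero, sub_zero] at h2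
  refine (Ideal.mul_unit_mem_iff_mem _ (isUnit_of_constantCoeff_ne_zero ?_)).1 h2
  rw [Polynomial.C_0, sub_zero, Polynomial.X_dvd_iff] at hq0
  have h5 : constantCoeff (Polynomial.aeval (X i : MvPowerSeries (Fin 2) ℂ) q) = q.coeff 0 := by
    rw [Polynomial.aeval_def, Polynomial.hom_eval₂, constantCoeff_X,
      show constantCoeff.comp (algebraMap ℂ (MvPowerSeries (Fin 2) ℂ)) = RingHom.id ℂ from
        constantCoeff_comp_C, Polynomial.eval₂_id, Polynomial.coeff_zero_eq_eval_zero]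
  rwa [h5]

/-! ### The inflection form of a weighted homogeneous form. -/

/-- The form `(f_j)² f_ii - 2 f_i f_j f_ij + (f_i)² f_jj`. -/
noncomputable def hessianForm (i j : Fin 2) (f : MvPowerSeries (Fin 2) ℂ) :
    MvPowerSeries (Fin 2) ℂ :=
  pderiv ℂ j f ^ 2 * pderiv ℂ i (pderiv ℂ i f) -
    2 * pderiv ℂ i f * pderiv ℂ j f * pderiv ℂ j (pderiv ℂ i f) +
    pderiv ℂ i f ^ 2 * pderiv ℂ j (pderiv ℂ j f)

theorem hessianForm_symm (i j : Fin 2) (f : MvPowerSeries (Fin 2) ℂ) :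
    hessianForm i j f = hessianForm j i f := by
  rw [hessianForm, hessianForm, pderiv_comm i j]
  ring

theorem HasInitialForm.hessianForm {w : Fin 2 → ℕ} {d : ℤ} {f g : MvPowerSeries (Fin 2) ℂ}
    (hf : HasInitialForm w d f g) (i j : Fin 2) :
    HasInitialForm w (3 * d - 2 * w i - 2 * w j) (hessianForm i j f) (hessianForm i j g) := by
  have h1 := ((hf.pderiv j).pow 2).mul ((hf.pderiv i).pderiv i)
  have h2 := (((of_isWeightForm (IsWeightForm.const (w := w) 2)).mul (hf.pderiv i)).mul
    (hf.pderiv j)).mul ((hf.pderiv i).pderiv j)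
  have h3 := ((hf.pderiv i).pow 2).mul ((hf.pderiv j).pderiv j)
  rw [show (C (2 : ℂ) : MvPowerSeries (Fin 2) ℂ) = 2 from map_ofNat C 2] at h2
  have e1 : ((2 : ℕ) : ℤ) * (d - w j) + (d - w i - w i) = 3 * d - 2 * w i - 2 * w j := by
    push_cast; ring
  have e2 : (0 : ℤ) + (d - w i) + (d - w j) + (d - w i - w j) = 3 * d - 2 * w i - 2 * w j := by
    ring
  have e3 : ((2 : ℕ) : ℤ) * (d - w i) + (d - w j - w j) = 3 * d - 2 * w i - 2 * w j := by
    push_cast; ring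
  rw [e1] at h1
  rw [e2] at h2
  rw [e3] at h3
  exact (h1.sub h2).add h3

section Form

variable {w : Fin 2 → ℕ} {d : ℤ} {g : MvPowerSeries (Fin 2) ℂ} {i j : Fin 2}

/-- Euler's relations for g_i and g_j eliminate the pure second derivatives. Modulo g, Euler's
relation for g gives w_i x_i g_i ≡ −w_j x_j g_j; the remaining mixed derivative then cancels. -/
theorem IsWeightForm.dvd_sub_hessianForm (hg : IsWeightForm w d g) (hij : i ≠ j) :
    g ∣ C ((w j : ℂ) * ((w i : ℂ) - w j)) * X j * MvPowerSeries.pderiv ℂ j g ^ 3 -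
      C (w i : ℂ) ^ 2 * MvPowerSeries.X i ^ 2 * PlaneGerm.hessianForm i j g := by
  have E0 := hg.euler hij
  have E1 := (hg.pderiv i).euler hij
  have E2 := (hg.pderiv j).euler hij
  rw [pderiv_comm i j] at E2
  rw [PlaneGerm.hessianForm]
  push_cast at E1 E2
  simp only [map_sub, map_mul] at E1 E2 ⊢
  generalize MvPowerSeries.pderiv ℂ j (MvPowerSeries.pderiv ℂ i g) = s at *
  generalize MvPowerSeries.pderiv ℂ i (MvPowerSeries.pderiv ℂ i g) = r at *
  generalize MvPowerSeries.pderiv ℂ j (MvPowerSeries.pderiv ℂ j g) = t at *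
  generalize MvPowerSeries.pderiv ℂ j g = q at *
  generalize MvPowerSeries.pderiv ℂ i g = p at *
  generalize (C (w i : ℂ) : MvPowerSeries (Fin 2) ℂ) = a at *
  generalize (C (w j : ℂ) : MvPowerSeries (Fin 2) ℂ) = b at *
  generalize (C (d : ℂ) : MvPowerSeries (Fin 2) ℂ) = D at *
  generalize (X i : MvPowerSeries (Fin 2) ℂ) = x at *
  generalize (X j : MvPowerSeries (Fin 2) ℂ) = y at *
  exact ⟨-(q ^ 2 * (D ^ 2 - a * D)) + 2 * (a * x) * s * q * D - t * (a * x * p - b * y * q) * D, by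
    linear_combination (-(q ^ 2 * (a * x))) * E1 - q ^ 2 * (b * y) * E2 -
      (q ^ 2 * (D - a) - 2 * (a * x) * s * q + t * (a * x * p - b * y * q)) * E0⟩

/-- A weighted homogeneous form which is prime to both variables is prime to its derivatives, when
the latter have finite intersection number. -/
theorem IsWeightForm.isRegularMod_pderiv (hg : IsWeightForm w d g) (hij : i ≠ j)
    (hwi : w i ≠ 0) (hX : ¬ MvPowerSeries.X i ∣ g)
    (hN : ∃ N, (MvPowerSeries.X i : MvPowerSeries (Fin 2) ℂ) ^ N ∈
      Ideal.span {MvPowerSeries.pderiv ℂ i g, MvPowerSeries.pderiv ℂ j g}) :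
    IsRegularMod g (MvPowerSeries.pderiv ℂ j g) := by
  intro a ha
  have hXi := isRegularMod_X hX
  -- Euler's relation turns divisibility of g_j a into divisibility of x_i g_i a, and x_i is prime
  -- to g. Thus g divides the whole Jacobian ideal times a, in particular x_i^N a.
  have h1 : g ∣ MvPowerSeries.pderiv ℂ i g * a := by
    refine hXi _ (IsRegularMod.of_isUnit (isUnit_C (Nat.cast_ne_zero.2 hwi)) _ ?_)
    have E0 := hg.euler hij
    have e : C (w i : ℂ) * (MvPowerSeries.X i * (MvPowerSeries.pderiv ℂ i g * a)) =
        g * (C (d : ℂ) * a) - C (w j : ℂ) * MvPowerSeries.X j *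
          (MvPowerSeries.pderiv ℂ j g * a) := by
      linear_combination a * E0
    rw [e]
    exact (dvd_mul_right g _).sub (ha.mul_left _)
  obtain ⟨N, hN⟩ := hN
  obtain ⟨b, c, hbc⟩ := Ideal.mem_span_pair.1 hN
  refine hXi.pow N a ?_
  rw [← hbc, add_mul, mul_assoc, mul_assoc]
  exact (h1.mul_left b).add (ha.mul_left c)

/-- Every factor of w_j(w_i − w_j) x_j g_j³ is regular modulo g; the constant is nonzero exactly
because the weights are positive and differ. -/
theorem IsWeightForm.isRegularMod_hessianForm (hg : IsWeightForm w d g) (hij : i ≠ j)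
    (hwj : w j ≠ 0) (hw : w i ≠ w j) (hX : ¬ MvPowerSeries.X j ∣ g)
    (hr : IsRegularMod g (MvPowerSeries.pderiv ℂ j g)) :
    IsRegularMod g (PlaneGerm.hessianForm i j g) := by
  refine IsRegularMod.of_dvd (IsRegularMod.of_dvd_sub ?_ (hg.dvd_sub_hessianForm hij))
    (dvd_mul_left _ _)
  refine ((IsRegularMod.of_isUnit (isUnit_C ?_)).mul (isRegularMod_X hX)).mul (hr.pow 3)
  exact mul_ne_zero (Nat.cast_ne_zero.2 hwj) (sub_ne_zero.2 (by exact_mod_cast hw))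

end Form

/-! ### Dimensions of quotients and counts of monomials. -/

/-- The hypothesis says J = (I : h), so multiplication by h gives the exact sequence 0 → R/J → R/I →
R/(I + (h)) → 0. -/
theorem Ideal.finrank_quotient_eq_add {K R : Type*} [Field K] [CommRing R] [Algebra K R]
    {I J : Ideal R} {h : R} (hIJ : ∀ a, h * a ∈ I ↔ a ∈ J) [Module.Finite K (R ⧸ I)] :
    Module.finrank K (R ⧸ I) =
      Module.finrank K (R ⧸ (I ⊔ Ideal.span {h})) + Module.finrank K (R ⧸ J) := by
  let φ : (R ⧸ J) →ₗ[K] (R ⧸ I) := (Submodule.mapQ J I (LinearMap.mulLeft R h)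
    fun a ha => (hIJ a).2 ha).restrictScalars K
  let π : (R ⧸ I) →ₗ[K] (R ⧸ (I ⊔ Ideal.span {h})) :=
    (Ideal.Quotient.factorₐ K (le_sup_left : I ≤ I ⊔ Ideal.span {h})).toLinearMap
  have hφ : Function.Injective φ := by
    rw [injective_iff_map_eq_zero]
    intro x hx
    obtain ⟨a, rfl⟩ := Ideal.Quotient.mk_surjective x
    exact Ideal.Quotient.eq_zero_iff_mem.2 ((hIJ a).1 (Ideal.Quotient.eq_zero_iff_mem.1 hx))
  have hπ : LinearMap.range π = ⊤ :=
    LinearMap.range_eq_top.2 (Ideal.Quotient.factor_surjective le_sup_left)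
  have hker : LinearMap.ker π = LinearMap.range φ := by
    ext x
    obtain ⟨a, rfl⟩ := Ideal.Quotient.mk_surjective x
    rw [LinearMap.mem_ker, LinearMap.mem_range]
    constructor
    · intro h0
      have h1 : a ∈ I ⊔ Ideal.span {h} := Ideal.Quotient.eq_zero_iff_mem.1 h0
      obtain ⟨b, hb, c, hc, rfl⟩ := Submodule.mem_sup.1 h1
      obtain ⟨e, rfl⟩ := Ideal.mem_span_singleton'.1 hc
      refine ⟨Ideal.Quotient.mk J e, ?_⟩
      change Ideal.Quotient.mk I (h * e) = Ideal.Quotient.mk I (b + e * h)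
      rw [Ideal.Quotient.mk_eq_mk_iff_sub_mem]
      rw [show h * e - (b + e * h) = -b by ring]
      exact neg_mem hb
    · rintro ⟨y, hy⟩
      obtain ⟨e, rfl⟩ := Ideal.Quotient.mk_surjective y
      rw [← hy]
      change Ideal.Quotient.mk (I ⊔ Ideal.span {h}) (h * e) = 0
      rw [Ideal.Quotient.eq_zero_iff_mem]
      exact Ideal.mem_sup_right (Ideal.mul_mem_right _ _ (Ideal.mem_span_singleton_self h))
  have key := LinearMap.finrank_range_add_finrank_ker π
  rw [hπ, finrank_top, hker, LinearMap.finrank_range_of_inj hφ] at key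
  exact key.symm

theorem Ideal.eq_of_le_of_finrank_quotient_eq {K R : Type*} [Field K] [CommRing R] [Algebra K R]
    {I J : Ideal R} (hIJ : I ≤ J) [Module.Finite K (R ⧸ I)]
    (h : Module.finrank K (R ⧸ I) = Module.finrank K (R ⧸ J)) : I = J := by
  let π : (R ⧸ I) →ₗ[K] (R ⧸ J) := (Ideal.Quotient.factorₐ K hIJ).toLinearMap
  have hs : Function.Surjective π := Ideal.Quotient.factor_surjective hIJ
  have : Module.Finite K (R ⧸ J) := Module.Finite.of_surjective π hs
  have hi : Function.Injective π := (LinearMap.injective_iff_surjective_of_finrank_eq_finrank h).2 hs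
  refine le_antisymm hIJ fun a ha => Ideal.Quotient.eq_zero_iff_mem.1 (hi ?_)
  rw [map_zero]
  exact Ideal.Quotient.eq_zero_iff_mem.2 ha

theorem finite_weight_lt {w : Fin 2 → ℕ} (hw : ∀ i, 0 < w i) (N : ℤ) :
    {n : Fin 2 →₀ ℕ | ((Finsupp.weight w n : ℕ) : ℤ) < N}.Finite := by
  refine (Set.finite_Iic (Finsupp.equivFunOnFinite.symm fun _ => N.toNat)).subset ?_
  intro n hn i
  have h1 : n i ≤ n i * w i := Nat.le_mul_of_pos_right _ (hw i)
  obtain ⟨j, hij⟩ : ∃ j, i ≠ j := ⟨1 - i, by fin_cases i <;> decide⟩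
  rw [Set.mem_ofPred_eq, weight_fin_two w n hij] at hn
  simp only [Finsupp.equivFunOnFinite_symm_apply_apply]
  have h2 : 0 ≤ ((n j * w j : ℕ) : ℤ) := Int.natCast_nonneg _
  zify at h1 ⊢
  push_cast at *
  omega

theorem nonempty_quotient_weightIdeal_equiv (w : Fin 2 → ℕ) (N : ℤ) :
    Nonempty ((MvPowerSeries (Fin 2) ℂ ⧸ weightIdeal w N) ≃ₗ[ℂ]
      ({n : Fin 2 →₀ ℕ | ((Finsupp.weight w n : ℕ) : ℤ) < N} → ℂ)) := by
  classical
  let φ : MvPowerSeries (Fin 2) ℂ →ₗ[ℂ]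
      ({n : Fin 2 →₀ ℕ | ((Finsupp.weight w n : ℕ) : ℤ) < N} → ℂ) :=
    LinearMap.pi fun n => coeff n.1
  have hs : Function.Surjective φ := by
    intro v
    refine ⟨fun n => if h : ((Finsupp.weight w n : ℕ) : ℤ) < N then v ⟨n, h⟩ else 0, ?_⟩
    ext ⟨n, hn⟩
    exact dif_pos hn
  have hk : LinearMap.ker φ = (weightIdeal w N).restrictScalars ℂ := by
    ext f
    rw [LinearMap.mem_ker, Submodule.restrictScalars_mem, mem_weightIdeal, funext_iff]
    constructor
    · intro h n hn
      by_contra hc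
      exact hn (h ⟨n, not_le.1 hc⟩)
    · rintro h ⟨n, hn⟩
      by_contra hc
      exact absurd (h n hc) (not_le.2 hn)
  exact ⟨(Submodule.Quotient.restrictScalarsEquiv ℂ (weightIdeal w N)).symm.trans
    ((Submodule.quotEquivOfEq _ _ hk.symm).trans (φ.quotKerEquivOfSurjective hs))⟩

theorem finite_quotient_weightIdeal {w : Fin 2 → ℕ} (hw : ∀ i, 0 < w i) (N : ℤ) :
    Module.Finite ℂ (MvPowerSeries (Fin 2) ℂ ⧸ weightIdeal w N) := by
  obtain ⟨φ⟩ := nonempty_quotient_weightIdeal_equiv w N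
  have := (finite_weight_lt hw N).to_subtype
  exact Module.Finite.equiv φ.symm

theorem finrank_quotient_weightIdeal {w : Fin 2 → ℕ} (hw : ∀ i, 0 < w i) (N : ℤ) :
    Module.finrank ℂ (MvPowerSeries (Fin 2) ℂ ⧸ weightIdeal w N) =
      {n : Fin 2 →₀ ℕ | ((Finsupp.weight w n : ℕ) : ℤ) < N}.ncard := by
  obtain ⟨φ⟩ := nonempty_quotient_weightIdeal_equiv w N
  have := (finite_weight_lt hw N).fintype
  rw [φ.finrank_eq, Module.finrank_fintype_fun_eq_card, Set.ncard_eq_toFinset_card',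
    Set.toFinset_card]

/-- Monomials with x-exponent at least a are x^a times an arbitrary monomial, whose weight is
smaller by a w₀. -/
theorem ncard_weight_lt_eq_add {w : Fin 2 → ℕ} (hw : ∀ i, 0 < w i) (a : ℕ) (N : ℤ) :
    {n : Fin 2 →₀ ℕ | ((Finsupp.weight w n : ℕ) : ℤ) < N}.ncard =
      {n : Fin 2 →₀ ℕ | n 0 < a ∧ ((Finsupp.weight w n : ℕ) : ℤ) < N}.ncard +
      {n : Fin 2 →₀ ℕ | ((Finsupp.weight w n : ℕ) : ℤ) < N - a * w 0}.ncard := by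
  have hinj : Function.Injective fun n : Fin 2 →₀ ℕ => n + Finsupp.single 0 a :=
    add_left_injective _
  have hwt : ∀ n : Fin 2 →₀ ℕ, Finsupp.weight w (n + Finsupp.single 0 a) =
      Finsupp.weight w n + a * w 0 := by
    intro n
    rw [map_add, Finsupp.weight_single, smul_eq_mul]
  have himg : (fun n : Fin 2 →₀ ℕ => n + Finsupp.single 0 a) ''
      {n : Fin 2 →₀ ℕ | ((Finsupp.weight w n : ℕ) : ℤ) < N - a * w 0} =
      {n : Fin 2 →₀ ℕ | ¬ n 0 < a ∧ ((Finsupp.weight w n : ℕ) : ℤ) < N} := by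
    ext n
    simp only [Set.mem_image, Set.mem_ofPred_eq, not_lt]
    constructor
    · rintro ⟨m, hm, rfl⟩
      rw [hwt]
      refine ⟨by simp, ?_⟩
      push_cast
      omega
    · rintro ⟨h1, h2⟩
      have h3 : n - Finsupp.single 0 a + Finsupp.single 0 a = n :=
        tsub_add_cancel_of_le (by simpa using h1)
      refine ⟨n - Finsupp.single 0 a, ?_, h3⟩
      rw [← h3, hwt] at h2
      push_cast at h2
      omega
  rw [← Set.ncard_image_of_injective {n : Fin 2 →₀ ℕ | ((Finsupp.weight w n : ℕ) : ℤ) <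
    N - a * w 0} hinj, himg, ← Set.ncard_union_eq ?_
    ((finite_weight_lt hw N).subset fun n hn => hn.2)
    ((finite_weight_lt hw N).subset fun n hn => hn.2)]
  · congr 1
    ext n
    simp only [Set.mem_union, Set.mem_ofPred_eq]
    tauto
  · rw [Set.disjoint_left]
    exact fun n h1 h2 => h2.1 h1.1

/-- The weight N fixes the x-exponent modulo w₁, and a residue class has k members below k w₁. The
lower bound on N makes the corresponding y-exponent nonnegative for all of them. -/
theorem ncard_weight_eq {w : Fin 2 → ℕ} (hw : ∀ i, 0 < w i) (hc : Nat.Coprime (w 0) (w 1))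
    (k : ℕ) {N : ℕ} (hN : k * (w 0 * w 1) ≤ N) :
    {n : Fin 2 →₀ ℕ | n 0 < k * w 1 ∧ Finsupp.weight w n = N}.ncard = k := by
  obtain ⟨u, -, hu⟩ := Nat.exists_mul_mod_eq_of_coprime N hc (hw 1).ne'
  have hcount : (k * w 1).count (· ≡ u [MOD w 1]) = k := by
    rw [Nat.count_modEq_card _ (hw 1), Nat.mul_mod_left, if_neg (by omega),
      Nat.mul_div_cancel _ (hw 1), add_zero]
  have hinj : Set.InjOn (fun n : Fin 2 →₀ ℕ => n 0)
      {n : Fin 2 →₀ ℕ | n 0 < k * w 1 ∧ Finsupp.weight w n = N} := by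
    intro m hm n hn hmn
    have h1 := hm.2
    have h0 : m 0 = n 0 := hmn
    rw [← hn.2, weight_fin_two w _ zero_ne_one, weight_fin_two w _ zero_ne_one, h0] at h1
    have h2 := Nat.eq_of_mul_eq_mul_right (hw 1) (Nat.add_left_cancel h1)
    ext i
    fin_cases i
    · exact hmn
    · exact h2
  have himg : (fun n : Fin 2 →₀ ℕ => n 0) ''
      {n : Fin 2 →₀ ℕ | n 0 < k * w 1 ∧ Finsupp.weight w n = N} =
      ((Finset.range (k * w 1)).filter (· ≡ u [MOD w 1]) : Set ℕ) := by
    ext x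
    simp only [Set.mem_image, Set.mem_ofPred_eq, Finset.coe_filter, Finset.mem_range]
    constructor
    · rintro ⟨n, ⟨h1, h2⟩, rfl⟩
      refine ⟨h1, Nat.ModEq.cancel_left_of_coprime (c := w 0) ?_ ?_⟩
      · rwa [Nat.gcd_comm]
      · refine Nat.ModEq.trans ?_ (Nat.ModEq.symm hu)
        rw [← h2, weight_fin_two w _ zero_ne_one, mul_comm]
        exact (Nat.ModEq.symm (by simp [Nat.ModEq]))
    · rintro ⟨h1, h2⟩
      have h3 : w 0 * x ≡ N [MOD w 1] := (h2.mul_left (w 0)).trans hu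
      have h4 : w 0 * x ≤ N := by
        refine le_trans ?_ hN
        calc w 0 * x ≤ w 0 * (k * w 1) := Nat.mul_le_mul_left _ h1.le
          _ = k * (w 0 * w 1) := by ring
      obtain ⟨y, hy⟩ := (Nat.modEq_iff_dvd' h4).1 h3
      refine ⟨Finsupp.single 0 x + Finsupp.single 1 y, ⟨by simpa using h1, ?_⟩, by simp⟩
      rw [map_add, Finsupp.weight_single, Finsupp.weight_single, smul_eq_mul, smul_eq_mul,
        mul_comm y, ← hy, mul_comm x]
      omega
  rw [← hinj.ncard_image, himg, Set.ncard_coe_finset,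
    ← Nat.count_eq_card_filter_range, hcount]

theorem ncard_weight_lt_add {w : Fin 2 → ℕ} (hw : ∀ i, 0 < w i) (hc : Nat.Coprime (w 0) (w 1))
    (k m : ℕ) :
    {n : Fin 2 →₀ ℕ | n 0 < k * w 1 ∧ ((Finsupp.weight w n : ℕ) : ℤ) <
        (k * (w 0 * w 1) + m : ℕ)}.ncard =
      {n : Fin 2 →₀ ℕ | n 0 < k * w 1 ∧ ((Finsupp.weight w n : ℕ) : ℤ) <
        (k * (w 0 * w 1) : ℕ)}.ncard + k * m := by
  induction m with
  | zero => rfl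
  | succ m ih =>
    have hfin : ∀ N : ℤ, {n : Fin 2 →₀ ℕ | n 0 < k * w 1 ∧
        ((Finsupp.weight w n : ℕ) : ℤ) < N}.Finite :=
      fun N => (finite_weight_lt hw N).subset fun n hn => hn.2
    have hfin2 : {n : Fin 2 →₀ ℕ | n 0 < k * w 1 ∧
        Finsupp.weight w n = k * (w 0 * w 1) + m}.Finite := by
      refine (hfin (k * (w 0 * w 1) + m + 1 : ℕ)).subset fun n hn => ⟨hn.1, ?_⟩
      rw [hn.2]
      push_cast
      omega
    have h1 := ncard_weight_eq hw hc k (Nat.le_add_right (k * (w 0 * w 1)) m)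
    rw [Nat.mul_succ, ← add_assoc (Set.ncard _), ← ih]
    refine Eq.trans ?_ (congrArg (_ + ·) h1)
    rw [← Set.ncard_union_eq ?_ (hfin _) hfin2]
    · congr 1
      ext n
      simp only [Set.mem_union, Set.mem_ofPred_eq, Nat.cast_lt]
      rw [← and_or_left, ← add_assoc, Order.lt_add_one_iff, le_iff_lt_or_eq]
    · rw [Set.disjoint_left]
      intro n h1 h2
      have := h1.2
      rw [h2.2] at this
      exact lt_irrefl _ this

/-! ### Weighted Bézout modulo terms of high weight. -/

section WeightedBezout

variable {w : Fin 2 → ℕ} {d e : ℤ} {f g h q : MvPowerSeries (Fin 2) ℂ}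

/-- Power series form a domain, so the initial form of a product is the nonzero product of initial
forms. Hence a part of a of weight below N − d would survive in f a. -/
theorem HasInitialForm.mul_mem_weightIdeal_iff (hf : HasInitialForm w d f g) (hg : g ≠ 0) (N : ℤ)
    (a : MvPowerSeries (Fin 2) ℂ) : f * a ∈ weightIdeal w N ↔ a ∈ weightIdeal w (N - d) := by
  constructor
  · intro ha
    have key : ∀ m : ℕ, (m : ℤ) ≤ N - d → a ∈ weightIdeal w m := by
      intro m
      induction m with
      | zero => intro _; rw [weightIdeal_of_nonpos (by simp)]; trivial
      | succ m ih =>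
        intro hm
        push_cast at hm ⊢
        have h1 := hasInitialForm_weightPart (ih (by omega))
        have h2 := (hf.mul h1).eq_zero (weightIdeal_anti (by omega) ha)
        have h3 := (mul_eq_zero.1 h2).resolve_left hg
        simpa [h3] using h1.2
    rcases le_total (N - d) 0 with h0 | h0
    · rw [weightIdeal_of_nonpos h0]
      trivial
    · have := key (N - d).toNat (by omega)
      rwa [Int.toNat_of_nonneg h0] at this
  · intro ha
    have := mul_mem_weightIdeal hf.mem ha
    rwa [add_sub_cancel] at this

/-- Regularity of q modulo g lets the lowest part of a be removed by a multiple of f, one weight at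
a time, until the weight reaches N − e. -/
theorem HasInitialForm.mul_mem_sup_iff (hf : HasInitialForm w d f g) (hh : HasInitialForm w e h q)
    (hg : g ≠ 0) (hr : IsRegularMod g q) (N : ℤ) (a : MvPowerSeries (Fin 2) ℂ) :
    h * a ∈ weightIdeal w N ⊔ Ideal.span {f} ↔
      a ∈ weightIdeal w (N - e) ⊔ Ideal.span {f} := by
  constructor
  · intro ha
    have key : ∀ m : ℕ, (m : ℤ) ≤ N - e → a ∈ weightIdeal w m ⊔ Ideal.span {f} := by
      intro m
      induction m with
      | zero => intro _; rw [weightIdeal_of_nonpos (by simp), top_sup_eq]; trivial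
      | succ m ih =>
        intro hm
        push_cast at hm ⊢
        obtain ⟨b, hb, c, hc, hbc⟩ := Submodule.mem_sup.1 (ih (by omega))
        have h1 : h * b ∈ weightIdeal w N ⊔ Ideal.span {f} := by
          have e1 : h * b = h * a - h * c := by rw [← hbc]; ring
          rw [e1]
          exact sub_mem ha (Ideal.mem_sup_right (Ideal.mul_mem_left _ _ hc))
        obtain ⟨r, hr1, s, hs, hrs⟩ := Submodule.mem_sup.1 h1
        obtain ⟨t, rfl⟩ := Ideal.mem_span_singleton.1 hs
        have hft : f * t ∈ weightIdeal w (e + m) := by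
          have e1 : f * t = h * b - r := by rw [← hrs]; ring
          rw [e1]
          exact sub_mem (mul_mem_weightIdeal hh.mem hb) (weightIdeal_anti (by omega) hr1)
        have ht := hasInitialForm_weightPart ((hf.mul_mem_weightIdeal_iff hg _ _).1 hft)
        have hb1 := hasInitialForm_weightPart hb
        have h2 := hh.mul hb1
        have h3 := hf.mul ht
        rw [add_sub_cancel] at h3
        -- Since e + m < N, the remainder r does not contribute in weight e + m, and the lowest
        -- parts of h b and f t agree.
        have h4 : q * weightPart w m b = g * weightPart w (e + m - d) t := by
          refine h2.unique (h3.congr ?_)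
          have e1 : f * t - h * b = -r := by rw [← hrs]; ring
          rw [e1]
          exact neg_mem (weightIdeal_anti (by omega) hr1)
        obtain ⟨u, hu⟩ := hr _ ⟨_, h4⟩
        have h5 : weightPart w m b = g * weightPart w (m - d) u := by
          rw [← hf.1.weightPart_mul, ← hu, (isWeightForm_weightPart w m b).weightPart_eq]
        have h6 := hf.mul (HasInitialForm.of_isWeightForm (isWeightForm_weightPart w (m - d) u))
        rw [add_sub_cancel, ← h5] at h6
        -- Subtracting this multiple of f cancels the part of b of weight m, completing the
        -- induction step.
        have h7 : b - f * weightPart w (m - d) u ∈ weightIdeal w (m + 1) := by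
          have := sub_mem hb1.2 h6.2
          rwa [sub_sub_sub_cancel_right] at this
        have e2 : a = (b - f * weightPart w (m - d) u) + (f * weightPart w (m - d) u + c) := by
          rw [← hbc]; ring
        rw [e2]
        exact add_mem (Ideal.mem_sup_left h7) (Ideal.mem_sup_right (add_mem
          (Ideal.mul_mem_right _ _ (Ideal.mem_span_singleton_self f)) hc))
    rcases le_total (N - e) 0 with h0 | h0
    · rw [weightIdeal_of_nonpos h0, top_sup_eq]
      trivial
    · have := key (N - e).toNat (by omega)
      rwa [Int.toNat_of_nonneg h0] at this
  · intro ha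
    obtain ⟨b, hb, c, hc, rfl⟩ := Submodule.mem_sup.1 ha
    rw [mul_add]
    refine add_mem (Ideal.mem_sup_left ?_) (Ideal.mem_sup_right (Ideal.mul_mem_left _ _ hc))
    have := mul_mem_weightIdeal hh.mem hb
    rwa [add_sub_cancel] at this

theorem finite_quotient_of_weightIdeal_le (hw : ∀ i, 0 < w i) {N : ℤ}
    {I : Ideal (MvPowerSeries (Fin 2) ℂ)} (hI : weightIdeal w N ≤ I) :
    Module.Finite ℂ (MvPowerSeries (Fin 2) ℂ ⧸ I) :=
  have := finite_quotient_weightIdeal hw N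
  Module.Finite.of_surjective (Ideal.Quotient.factorₐ ℂ hI).toLinearMap
    (Ideal.Quotient.factor_surjective hI)

/-- The exact sequence for multiplication by f gives the count below N minus the count below N − a
w₀, as if f were x^a. -/
theorem HasInitialForm.finrank_quotient_weightIdeal_sup (hw : ∀ i, 0 < w i) {a : ℕ}
    (hf : HasInitialForm w (a * w 0) f g) (hg : g ≠ 0) (N : ℤ) :
    Module.finrank ℂ (MvPowerSeries (Fin 2) ℂ ⧸ (weightIdeal w N ⊔ Ideal.span {f})) =
      {n : Fin 2 →₀ ℕ | n 0 < a ∧ ((Finsupp.weight w n : ℕ) : ℤ) < N}.ncard := by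
  have := finite_quotient_weightIdeal hw N
  have h1 := Ideal.finrank_quotient_eq_add (K := ℂ) (hf.mul_mem_weightIdeal_iff hg N)
  rw [finrank_quotient_weightIdeal hw, finrank_quotient_weightIdeal hw,
    ncard_weight_lt_eq_add hw a] at h1
  omega

/-- Multiplication by h compares the truncations at N and N − e. Both lie in the range where each
weight contributes k, so the counts differ by ke. -/
theorem HasInitialForm.finrank_quotient_weightIdeal_sup_sup (hw : ∀ i, 0 < w i)
    (hc : Nat.Coprime (w 0) (w 1)) {k : ℕ}
    (hf : HasInitialForm w (k * (w 0 * w 1) : ℕ) f g) (hh : HasInitialForm w e h q)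
    (hg : g ≠ 0) (hr : IsRegularMod g q) {N : ℤ} (hN : (k * (w 0 * w 1) : ℕ) ≤ N)
    (hNe : (k * (w 0 * w 1) : ℕ) ≤ N - e) :
    (Module.finrank ℂ (MvPowerSeries (Fin 2) ℂ ⧸
      (weightIdeal w N ⊔ Ideal.span {f} ⊔ Ideal.span {h})) : ℤ) = k * e := by
  have := finite_quotient_of_weightIdeal_le hw
    (le_sup_left : weightIdeal w N ≤ weightIdeal w N ⊔ Ideal.span {f})
  have h1 := Ideal.finrank_quotient_eq_add (K := ℂ) (hf.mul_mem_sup_iff hh hg hr N)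
  have hf' : HasInitialForm w ((k * w 1 : ℕ) * w 0) f g := by
    convert hf using 1
    push_cast
    ring
  rw [hf'.finrank_quotient_weightIdeal_sup hw hg, hf'.finrank_quotient_weightIdeal_sup hw hg] at h1
  obtain ⟨m, rfl⟩ := Int.le.dest hN
  obtain ⟨m', hm'⟩ := Int.le.dest hNe
  rw [← hm', ← Nat.cast_add, ← Nat.cast_add, ncard_weight_lt_add hw hc,
    ncard_weight_lt_add hw hc] at h1
  have h2 : e = m - m' := by linarith
  rw [h2, ← Nat.cast_add]
  have key : ∀ c D m m' : ℕ, c + k * m = D + (c + k * m') → (D : ℤ) = k * (m - m') := by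
    intro c D m m' hD
    zify at hD
    linarith
  exact key _ _ _ _ h1

end WeightedBezout

/-! ### Weight filtration against powers of the maximal ideal. -/

/-- The ideal of the power series without constant term, given by its generators. -/
noncomputable def maxIdeal : Ideal (MvPowerSeries (Fin 2) ℂ) := Ideal.span (Set.range X)

theorem maxIdeal_le_jacobson : maxIdeal ≤ Ideal.jacobson ⊥ := by
  rw [IsLocalRing.jacobson_eq_maximalIdeal ⊥ bot_ne_top, maxIdeal, Ideal.span_le]
  rintro _ ⟨i, rfl⟩
  rw [SetLike.mem_coe, IsLocalRing.mem_maximalIdeal, mem_nonunits_iff, isUnit_iff_constantCoeff,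
    constantCoeff_X]
  simp

theorem maxIdeal_pow_fg (M : ℕ) : (maxIdeal ^ M).FG :=
  Ideal.FG.pow (Submodule.fg_span (Set.finite_range _))

theorem maxIdeal_pow_le_weightIdeal {w : Fin 2 → ℕ} (hw : ∀ i, 0 < w i) (M : ℕ) :
    maxIdeal ^ M ≤ weightIdeal w M := by
  induction M with
  | zero => rw [weightIdeal_of_nonpos (by simp)]; exact le_top
  | succ M ih =>
    rw [pow_succ, Ideal.mul_le]
    intro a ha b hb
    push_cast
    refine mul_mem_weightIdeal (ih ha) ((Ideal.span_le.2 ?_ : maxIdeal ≤ weightIdeal w 1) hb)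
    rintro _ ⟨i, rfl⟩
    exact weightIdeal_anti (by exact_mod_cast hw i) (IsWeightForm.var i).mem_weightIdeal

/-- The sum of the terms of `f` divisible by `x_i`, divided by `x_i`. -/
noncomputable def divX (i : Fin 2) (f : MvPowerSeries (Fin 2) ℂ) : MvPowerSeries (Fin 2) ℂ :=
  fun n => coeff (n + Finsupp.single i 1) f

theorem coeff_divX (i : Fin 2) (f : MvPowerSeries (Fin 2) ℂ) (n : Fin 2 →₀ ℕ) :
    coeff n (divX i f) = coeff (n + Finsupp.single i 1) f := rfl

theorem coeff_X_mul_divX (i : Fin 2) (f : MvPowerSeries (Fin 2) ℂ) (n : Fin 2 →₀ ℕ) :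
    coeff n (X i * divX i f) = if n i = 0 then 0 else coeff n f := by
  rw [X_def, coeff_monomial_mul]
  by_cases h : n i = 0
  · rw [if_neg (fun hc => by simpa [h] using hc i), if_pos h]
  · have hle : Finsupp.single i 1 ≤ n := by simpa using Nat.one_le_iff_ne_zero.2 h
    rw [if_pos hle, if_neg h, one_mul, coeff_divX, tsub_add_cancel_of_le hle]

/-- The terms containing x go to the first summand; what remains is a series in y alone, divided by
y in the second. -/
theorem eq_X_mul_divX_add {f : MvPowerSeries (Fin 2) ℂ} (hf : constantCoeff f = 0) :
    f = X 0 * divX 0 f + X 1 * divX 1 (f - X 0 * divX 0 f) := by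
  ext n
  rw [map_add, coeff_X_mul_divX, coeff_X_mul_divX, map_sub, coeff_X_mul_divX]
  by_cases h0 : n 0 = 0
  · by_cases h1 : n 1 = 0
    · have : n = 0 := by ext i; fin_cases i <;> assumption
      simpa [this] using hf
    · simp [h0, h1]
  · by_cases h1 : n 1 = 0 <;> simp [h0, h1]

theorem divX_mem_weightIdeal {w : Fin 2 → ℕ} {N : ℤ} (i : Fin 2) {f : MvPowerSeries (Fin 2) ℂ}
    (hf : f ∈ weightIdeal w N) : divX i f ∈ weightIdeal w (N - w i) := by
  intro n hn
  have h := hf _ hn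
  rw [weight_add_single] at h
  push_cast at h
  omega

theorem constantCoeff_of_mem_weightIdeal {w : Fin 2 → ℕ} {N : ℤ} (hN : 0 < N)
    {f : MvPowerSeries (Fin 2) ℂ} (hf : f ∈ weightIdeal w N) : constantCoeff f = 0 := by
  by_contra h
  rw [← coeff_zero_eq_constantCoeff_apply] at h
  have := hf 0 h
  simp at this
  omega

theorem X_mul_divX_mem_weightIdeal {w : Fin 2 → ℕ} {N : ℤ} (i : Fin 2)
    {f : MvPowerSeries (Fin 2) ℂ} (hf : f ∈ weightIdeal w N) :
    X i * divX i f ∈ weightIdeal w N := by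
  intro n hn
  rw [coeff_X_mul_divX] at hn
  split_ifs at hn
  · simp at hn
  · exact hf n hn

theorem weightIdeal_one_le_maxIdeal_pow (M : ℕ) : weightIdeal 1 M ≤ maxIdeal ^ M := by
  induction M with
  | zero => simp
  | succ M ih =>
    intro f hf
    have h0 := X_mul_divX_mem_weightIdeal 0 hf
    have hX : ∀ i, (X i : MvPowerSeries (Fin 2) ℂ) ∈ maxIdeal :=
      fun i => Ideal.subset_span ⟨i, rfl⟩
    have hd : ∀ i, ∀ f ∈ weightIdeal 1 ((M + 1 : ℕ) : ℤ), divX i f ∈ maxIdeal ^ M := by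
      intro i f hf
      refine ih ?_
      simpa using divX_mem_weightIdeal i hf
    rw [eq_X_mul_divX_add (constantCoeff_of_mem_weightIdeal (by positivity) hf), pow_succ']
    exact add_mem (Ideal.mul_mem_mul (hX 0) (hd 0 f hf))
      (Ideal.mul_mem_mul (hX 1) (hd 1 _ (sub_mem hf h0)))

/-- A monomial of degree below M has weight below M(w₀ + w₁). -/
theorem weightIdeal_le_weightIdeal_one {w : Fin 2 → ℕ} (hw : ∀ i, 0 < w i) (M : ℕ) :
    weightIdeal w ((M * (w 0 + w 1) : ℕ) : ℤ) ≤ weightIdeal 1 M := by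
  intro f hf n hn
  have h := hf n hn
  rw [weight_fin_two w n zero_ne_one] at h
  rw [weight_fin_two 1 n zero_ne_one]
  simp only [Pi.one_apply, mul_one]
  by_contra hc
  have hc' : n 0 + n 1 + 1 ≤ M := by
    push_cast at hc
    omega
  have h' : M * (w 0 + w 1) ≤ n 0 * w 0 + n 1 * w 1 := by exact_mod_cast h
  have h0 : n 0 * w 0 ≤ (n 0 + n 1) * w 0 := Nat.mul_le_mul_right _ (by omega)
  have h1 : n 1 * w 1 ≤ (n 0 + n 1) * w 1 := Nat.mul_le_mul_right _ (by omega)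
  have h2 : (n 0 + n 1 + 1) * (w 0 + w 1) ≤ M * (w 0 + w 1) := Nat.mul_le_mul_right _ hc'
  have := hw 0
  nlinarith

theorem weightIdeal_le_maxIdeal_pow {w : Fin 2 → ℕ} (hw : ∀ i, 0 < w i) (M : ℕ) :
    weightIdeal w ((M * (w 0 + w 1) : ℕ) : ℤ) ≤ maxIdeal ^ M :=
  (weightIdeal_le_weightIdeal_one hw M).trans (weightIdeal_one_le_maxIdeal_pow M)

theorem finite_quotient_of_maxIdeal_pow_le {M : ℕ} {I : Ideal (MvPowerSeries (Fin 2) ℂ)}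
    (hI : maxIdeal ^ M ≤ I) : Module.Finite ℂ (MvPowerSeries (Fin 2) ℂ ⧸ I) :=
  finite_quotient_of_weightIdeal_le (fun _ => Nat.one_pos)
    ((weightIdeal_one_le_maxIdeal_pow M).trans hI)

/-- Weighted Bézout: germs whose initial forms, of degrees `d` and `e` for the weights `w`, have no
common factor have intersection number `d e / (w₀ w₁)` (here for `d` divisible by `w₀ w₁`). -/
theorem HasInitialForm.finrank_quotient_span_pair {w : Fin 2 → ℕ} (hw : ∀ i, 0 < w i)
    (hc : Nat.Coprime (w 0) (w 1)) {k : ℕ} {e : ℤ} {f g h q : MvPowerSeries (Fin 2) ℂ}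
    (hf : HasInitialForm w (k * (w 0 * w 1) : ℕ) f g) (hh : HasInitialForm w e h q)
    (hg : g ≠ 0) (hr : IsRegularMod g q) :
    (∃ M, maxIdeal ^ M ≤ Ideal.span {f, h}) ∧
      (Module.finrank ℂ (MvPowerSeries (Fin 2) ℂ ⧸ Ideal.span {f, h}) : ℤ) = k * e := by
  have hspan : ∀ N, weightIdeal w N ⊔ Ideal.span {f} ⊔ Ideal.span {h} =
      weightIdeal w N ⊔ Ideal.span {f, h} := by
    intro N
    rw [sup_assoc, ← Ideal.span_union, Set.singleton_union]
  obtain ⟨M, hM⟩ : ∃ M : ℕ, (k * (w 0 * w 1) : ℕ) ≤ (M : ℤ) ∧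
      (k * (w 0 * w 1) : ℕ) ≤ (M : ℤ) - e :=
    ⟨k * (w 0 * w 1) + e.toNat, by push_cast; omega, by push_cast; omega⟩
  have hdim : ∀ N : ℤ, (M : ℤ) ≤ N → (Module.finrank ℂ (MvPowerSeries (Fin 2) ℂ ⧸
      (weightIdeal w N ⊔ Ideal.span {f, h})) : ℤ) = k * e := by
    intro N hN
    rw [← hspan]
    exact hf.finrank_quotient_weightIdeal_sup_sup hw hc hh hg hr (by omega) (by omega)
  -- The truncated ideals are nested and have the same codimension from M on, so they coincide.
  have hstab : ∀ N : ℤ, (M : ℤ) ≤ N → weightIdeal w M ≤ weightIdeal w N ⊔ Ideal.span {f, h} := by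
    intro N hN
    have := finite_quotient_of_weightIdeal_le hw
      (le_sup_left : weightIdeal w N ≤ weightIdeal w N ⊔ Ideal.span {f, h})
    rw [Ideal.eq_of_le_of_finrank_quotient_eq (K := ℂ)
      (sup_le_sup_right (weightIdeal_anti hN) (Ideal.span {f, h}))
      (by exact_mod_cast (hdim N hN).trans (hdim M le_rfl).symm)]
    exact le_sup_left
  have hle : maxIdeal ^ M ≤ Ideal.span {f, h} := by
    -- Nakayama: it suffices that 𝔪^M ⊆ ⟨f, h⟩ + 𝔪^(M+1). Stabilisation gives this with N = (M+1)(w₀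
    -- + w₁), for which terms of weight ≥ N lie in 𝔪^(M+1).
    refine Submodule.le_of_le_smul_of_le_jacobson_bot (maxIdeal_pow_fg M) maxIdeal_le_jacobson ?_
    refine (maxIdeal_pow_le_weightIdeal hw M).trans ?_
    have hN : (M : ℤ) ≤ (((M + 1) * (w 0 + w 1) : ℕ) : ℤ) := by
      have := hw 0
      have : M ≤ (M + 1) * (w 0 + w 1) :=
        (Nat.le_succ M).trans (Nat.le_mul_of_pos_right _ (by omega))
      exact_mod_cast this
    refine (hstab _ hN).trans ?_
    rw [smul_eq_mul, ← pow_succ', sup_comm]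
    exact sup_le_sup_left (weightIdeal_le_maxIdeal_pow hw (M + 1)) _
  refine ⟨⟨M, hle⟩, ?_⟩
  have hN : (M : ℤ) ≤ ((M * (w 0 + w 1) : ℕ) : ℤ) := by
    have := hw 0
    have : M ≤ M * (w 0 + w 1) := Nat.le_mul_of_pos_right _ (by omega)
    exact_mod_cast this
  have := hdim _ hN
  rwa [sup_eq_right.2 ((weightIdeal_le_maxIdeal_pow hw M).trans hle)] at this

/-! ### Convergent series and comparison with formal series. -/

theorem Converges.divX {f : MvPowerSeries (Fin 2) ℂ} (hf : Converges f) (i : Fin 2) :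
    Converges (divX i f) := by
  obtain ⟨r, hr, hf⟩ := hf
  refine ⟨r, hr, ?_⟩
  have hinj : Function.Injective fun n : Fin 2 →₀ ℕ => n + Finsupp.single i 1 :=
    add_left_injective _
  refine ((hf.comp_injective hinj).mul_left r⁻¹).congr fun n => ?_
  rw [Function.comp_apply, map_add, Finsupp.degree_single, pow_succ, coeff_divX]
  field_simp

theorem summable_half_pow_degree : Summable fun n : Fin 2 →₀ ℕ => (1 / 2 : ℝ) ^ n.degree := by
  have h : Summable fun x : ℕ × ℕ => (1 / 2 : ℝ) ^ x.1 * (1 / 2 : ℝ) ^ x.2 :=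
    summable_geometric_two.mul_of_nonneg summable_geometric_two
      (fun n => by positivity) (fun n => by positivity)
  refine ((Finsupp.equivFunOnFinite.trans (finTwoArrowEquiv ℕ)).summable_iff.2 h).congr
    fun n => ?_
  rw [Finsupp.degree_eq_sum, Fin.sum_univ_two, pow_add]
  rfl

theorem Converges.of_bounded {f : MvPowerSeries (Fin 2) ℂ} {r c : ℝ} (hr : 0 < r)
    (h : ∀ n, ‖coeff n f‖ * r ^ n.degree ≤ c) : Converges f := by
  refine ⟨r / 2, by positivity, ?_⟩
  refine (summable_half_pow_degree.mul_left c).of_nonneg_of_le (fun n => by positivity) fun n => ?_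
  rw [div_eq_mul_one_div, mul_pow, ← mul_assoc]
  gcongr
  exact h n

/-- On a small polydisc, a convergent series without constant term has norm at most one. -/
theorem Converges.exists_tsum_le_one {f : MvPowerSeries (Fin 2) ℂ} (hf : Converges f)
    (h0 : constantCoeff f = 0) :
    ∃ r : ℝ, 0 < r ∧ (Summable fun n : Fin 2 →₀ ℕ => ‖coeff n f‖ * r ^ n.degree) ∧
      ∑' n : Fin 2 →₀ ℕ, ‖coeff n f‖ * r ^ n.degree ≤ 1 := by
  obtain ⟨r, hr, hf⟩ := hf
  set S := ∑' n : Fin 2 →₀ ℕ, ‖coeff n f‖ * r ^ n.degree with hS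
  have hS0 : 0 ≤ S := tsum_nonneg fun n => by positivity
  -- Without a constant term, shrinking the radius by t multiplies every term by at most t, and tS ≤
  -- 1.
  set t : ℝ := (S + 1)⁻¹ with ht
  have ht0 : 0 < t := by positivity
  have ht1 : t ≤ 1 := inv_le_one_of_one_le₀ (by linarith)
  have hle : ∀ n : Fin 2 →₀ ℕ, ‖coeff n f‖ * (r * t) ^ n.degree ≤
      t * (‖coeff n f‖ * r ^ n.degree) := by
    intro n
    by_cases hn : n = 0
    · subst hn
      rw [coeff_zero_eq_constantCoeff_apply, h0]
      simp
    · have h1 : t ^ n.degree ≤ t := by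
        refine pow_le_of_le_one ht0.le ht1 ?_
        rwa [Ne, Finsupp.degree_eq_zero_iff]
      rw [mul_pow]
      calc ‖coeff n f‖ * (r ^ n.degree * t ^ n.degree)
          ≤ ‖coeff n f‖ * (r ^ n.degree * t) := by gcongr
        _ = t * (‖coeff n f‖ * r ^ n.degree) := by ring
  have hsum := (hf.mul_left t).of_nonneg_of_le (fun n => by positivity) hle
  refine ⟨r * t, by positivity, hsum, ?_⟩
  refine (hsum.tsum_le_tsum hle (hf.mul_left t)).trans ?_
  rw [tsum_mul_left, ← hS, ht, inv_mul_le_iff₀ (by positivity)]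
  linarith

/-- This is the geometric series for 1/(1 − u). On a polydisc where the norm of u is at most 1, the
recursion bounds each weighted coefficient of v by 1, by induction on degree. -/
theorem Converges.of_eq_one_add_mul {u v : MvPowerSeries (Fin 2) ℂ} (hu : Converges u)
    (h0 : constantCoeff u = 0) (hv : v = 1 + u * v) : Converges v := by
  classical
  obtain ⟨r, hr, hsum, hle⟩ := hu.exists_tsum_le_one h0
  refine Converges.of_bounded (c := 1) hr fun n => ?_
  induction hm : n.degree using Nat.strong_induction_on generalizing n with
  | _ m ih =>
  subst hm
  by_cases hn : n = 0
  · subst hn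
    rw [hv]
    simp [h0]
  · have h1 : coeff n v = coeff n (u * v) := by
      conv_lhs => rw [hv]
      rw [map_add, coeff_one, if_neg hn, zero_add]
    rw [h1]
    refine (norm_coeff_mul_le u v hr n).trans ?_
    have h2 : ∀ p ∈ Finset.HasAntidiagonal.antidiagonal n,
        (‖coeff p.1 u‖ * r ^ p.1.degree) * (‖coeff p.2 v‖ * r ^ p.2.degree) ≤
          ‖coeff p.1 u‖ * r ^ p.1.degree := by
      intro p hp
      by_cases hp0 : p.1 = 0
      · rw [hp0, coeff_zero_eq_constantCoeff_apply, h0]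
        simp
      · refine mul_le_of_le_one_right (by positivity) (ih _ ?_ p.2 rfl)
        rw [← Finset.HasAntidiagonal.mem_antidiagonal.1 hp, map_add]
        have : p.1.degree ≠ 0 := by rwa [Ne, Finsupp.degree_eq_zero_iff]
        omega
    refine (Finset.sum_le_sum h2).trans (le_trans ?_ hle)
    have hinj : Set.InjOn Prod.fst
        (Finset.HasAntidiagonal.antidiagonal n : Set ((Fin 2 →₀ ℕ) × (Fin 2 →₀ ℕ))) := by
      intro p hp q hq hpq
      have hp' := Finset.HasAntidiagonal.mem_antidiagonal.1 (Finset.mem_coe.1 hp)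
      have hq' := Finset.HasAntidiagonal.mem_antidiagonal.1 (Finset.mem_coe.1 hq)
      refine Prod.ext hpq (add_left_cancel (a := p.1) ?_)
      rw [hp', hpq, hq']
    rw [← Finset.sum_image (f := fun m => ‖coeff m u‖ * r ^ m.degree) hinj]
    exact hsum.sum_le_tsum _ fun m _ => by positivity

theorem O2.isUnit_of_constantCoeff_ne_zero {f : O2}
    (hf : constantCoeff (f : MvPowerSeries (Fin 2) ℂ) ≠ 0) : IsUnit f := by
  set c := constantCoeff (f : MvPowerSeries (Fin 2) ℂ) with hc
  have hinv := MvPowerSeries.mul_inv_cancel (f : MvPowerSeries (Fin 2) ℂ) hf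
  -- Normalising f to constant term 1, v is the inverse of f/c and satisfies v = 1 + (1 − f/c)v.
  set v := C c * (f : MvPowerSeries (Fin 2) ℂ)⁻¹ with hv
  have hC : ∀ a : ℂ, (C a : MvPowerSeries (Fin 2) ℂ) ∈ O2 := fun a => O2.algebraMap_mem a
  have hCc : (C c⁻¹ : MvPowerSeries (Fin 2) ℂ) * C c = 1 := by
    rw [← map_mul, inv_mul_cancel₀ hf, map_one]
  have hu : Converges (1 - C c⁻¹ * (f : MvPowerSeries (Fin 2) ℂ)) :=
    O2.sub_mem O2.one_mem (O2.mul_mem (hC _) f.2)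
  have hvc : Converges v := by
    refine hu.of_eq_one_add_mul ?_ ?_
    · rw [map_sub, map_mul, constantCoeff_C, ← hc, inv_mul_cancel₀ hf, map_one, sub_self]
    · rw [hv]
      linear_combination (C c⁻¹ * C c) * hinv + hCc
  refine IsUnit.of_mul_eq_one (⟨C c⁻¹ * v, O2.mul_mem (hC _) hvc⟩ : O2) (Subtype.ext ?_)
  change (f : MvPowerSeries (Fin 2) ℂ) * (C c⁻¹ * v) = 1
  rw [hv]
  linear_combination (C c⁻¹ * C c) * hinv + hCc

/-- The ideal of `𝒪₂` generated by the two variables. -/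
noncomputable def maxIdealO2 : Ideal O2 :=
  Ideal.span (Set.range fun i => ofPoly (MvPolynomial.X i))

theorem coe_ofPoly_X (i : Fin 2) :
    ((ofPoly (MvPolynomial.X i) : O2) : MvPowerSeries (Fin 2) ℂ) = X i := MvPolynomial.coe_X i

theorem map_maxIdealO2 : maxIdealO2.map O2.val = maxIdeal := by
  rw [maxIdealO2, maxIdeal, Ideal.map_span, ← Set.range_comp]
  congr 2
  ext1 i
  exact coe_ofPoly_X i

theorem maxIdealO2_le_jacobson : maxIdealO2 ≤ Ideal.jacobson ⊥ := by
  rw [maxIdealO2, Ideal.span_le]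
  rintro _ ⟨i, rfl⟩
  rw [SetLike.mem_coe, Ideal.mem_jacobson_bot]
  intro y
  refine O2.isUnit_of_constantCoeff_ne_zero ?_
  change constantCoeff (((ofPoly (MvPolynomial.X i) : O2) : MvPowerSeries (Fin 2) ℂ) *
    (y : MvPowerSeries (Fin 2) ℂ) + 1) ≠ 0
  rw [coe_ofPoly_X]
  simp

theorem mem_maxIdealO2_pow {M : ℕ} {f : O2}
    (hf : (f : MvPowerSeries (Fin 2) ℂ) ∈ weightIdeal 1 M) : f ∈ maxIdealO2 ^ M := by
  induction M generalizing f with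
  | zero => simp
  | succ M ih =>
    have h0 := X_mul_divX_mem_weightIdeal 0 hf
    have hX : ∀ i, ofPoly (MvPolynomial.X i) ∈ maxIdealO2 :=
      fun i => Ideal.subset_span ⟨i, rfl⟩
    have hX0 : (X 0 : MvPowerSeries (Fin 2) ℂ) ∈ O2 := by
      rw [← coe_ofPoly_X]
      exact (ofPoly (MvPolynomial.X 0)).2
    have hb : Converges (divX 1 (f.1 - X 0 * divX 0 f.1)) :=
      Converges.divX (O2.sub_mem f.2 (O2.mul_mem hX0 (Converges.divX f.2 0))) 1
    have e : f = ofPoly (MvPolynomial.X 0) * ⟨divX 0 f.1, Converges.divX f.2 0⟩ +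
        ofPoly (MvPolynomial.X 1) * ⟨divX 1 (f.1 - X 0 * divX 0 f.1), hb⟩ := by
      refine Subtype.ext ?_
      rw [Subalgebra.coe_add, Subalgebra.coe_mul, Subalgebra.coe_mul, coe_ofPoly_X, coe_ofPoly_X]
      exact eq_X_mul_divX_add (constantCoeff_of_mem_weightIdeal (by positivity) hf)
    rw [e, pow_succ']
    refine add_mem (Ideal.mul_mem_mul (hX 0) (ih ?_)) (Ideal.mul_mem_mul (hX 1) (ih ?_))
    · simpa using divX_mem_weightIdeal 0 hf
    · simpa using divX_mem_weightIdeal 1 (sub_mem hf h0)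

theorem sub_truncTotal_mem_weightIdeal (a : MvPowerSeries (Fin 2) ℂ) (N : ℕ) :
    a - (truncTotal N a : MvPowerSeries (Fin 2) ℂ) ∈ weightIdeal 1 N := by
  intro n hn
  by_contra hlt
  have hlt' : n.degree < N := by rw [Finsupp.degree_eq_weight_one]; exact_mod_cast not_le.1 hlt
  rw [map_sub, MvPolynomial.coeff_coe, coeff_truncTotal _ hlt', sub_self] at hn
  exact hn rfl

theorem exists_O2_sub_mem_weightIdeal (a : MvPowerSeries (Fin 2) ℂ) (N : ℕ) :
    ∃ b : O2, a - b ∈ weightIdeal 1 N :=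
  ⟨ofPoly (truncTotal N a), sub_truncTotal_mem_weightIdeal a N⟩

/-- Truncating the formal coefficients to polynomials leaves an error that is a convergent germ of
order at least N. -/
theorem exists_O2_combination {f h u : O2} (hu : (u : MvPowerSeries (Fin 2) ℂ) ∈
    Ideal.span {(f : MvPowerSeries (Fin 2) ℂ), (h : MvPowerSeries (Fin 2) ℂ)}) (N : ℕ) :
    u ∈ Ideal.span {f, h} ⊔ maxIdealO2 ^ N := by
  obtain ⟨a, b, hab⟩ := Ideal.mem_span_pair.1 hu
  obtain ⟨a', ha⟩ := exists_O2_sub_mem_weightIdeal a N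
  obtain ⟨b', hb⟩ := exists_O2_sub_mem_weightIdeal b N
  rw [← add_sub_cancel (a' * f + b' * h) u]
  refine add_mem (Ideal.mem_sup_left (Ideal.mem_span_pair.2 ⟨a', b', rfl⟩))
    (Ideal.mem_sup_right (mem_maxIdealO2_pow ?_))
  change (u : MvPowerSeries (Fin 2) ℂ) - ((a' : MvPowerSeries (Fin 2) ℂ) * f + b' * h) ∈ _
  have e : (u : MvPowerSeries (Fin 2) ℂ) - ((a' : MvPowerSeries (Fin 2) ℂ) * f + b' * h) =
      (a - a') * f + (b - b') * h := by
    rw [← hab]; ring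
  rw [e]
  exact add_mem (Ideal.mul_mem_right _ _ ha) (Ideal.mul_mem_right _ _ hb)

/-- The intersection number of convergent series can be computed with formal series, when the
ideal is primary to the maximal ideal. -/
theorem intersectionNumber_eq_finrank {f h : O2} {M : ℕ} (hM : maxIdeal ^ M ≤
    Ideal.span {(f : MvPowerSeries (Fin 2) ℂ), (h : MvPowerSeries (Fin 2) ℂ)}) :
    intersectionNumber f h = (Module.finrank ℂ (MvPowerSeries (Fin 2) ℂ ⧸
      Ideal.span {(f : MvPowerSeries (Fin 2) ℂ), (h : MvPowerSeries (Fin 2) ℂ)}) : ℕ) := by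
  -- Nakayama in 𝒪₂: formal membership gives convergent membership modulo the next power of the
  -- maximal ideal. This yields injectivity below; surjectivity comes from polynomial truncation.
  have hle : maxIdealO2 ^ M ≤ Ideal.span {f, h} := by
    refine Submodule.le_of_le_smul_of_le_jacobson_bot (I := maxIdealO2)
      (Ideal.FG.pow (Submodule.fg_span (Set.finite_range _))) maxIdealO2_le_jacobson ?_
    intro u hu
    rw [smul_eq_mul, ← pow_succ']
    refine exists_O2_combination (hM ?_) (M + 1)
    have := Ideal.mem_map_of_mem O2.val hu
    rwa [Ideal.map_pow, map_maxIdealO2] at this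
  set I := Ideal.span {(f : MvPowerSeries (Fin 2) ℂ), (h : MvPowerSeries (Fin 2) ℂ)} with hI
  have hcomap : Ideal.span {f, h} ≤ I.comap O2.val := by
    rw [Ideal.span_le]
    rintro u (rfl | rfl)
    · exact Ideal.subset_span (Or.inl rfl)
    · exact Ideal.subset_span (Or.inr rfl)
  let φ : (O2 ⧸ Ideal.span {f, h}) →ₗ[ℂ] (MvPowerSeries (Fin 2) ℂ ⧸ I) :=
    (Ideal.quotientMapₐ I O2.val hcomap).toLinearMap
  have hinj : Function.Injective φ := by
    rw [injective_iff_map_eq_zero]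
    intro x hx
    obtain ⟨u, rfl⟩ := Ideal.Quotient.mk_surjective x
    have hu : (u : MvPowerSeries (Fin 2) ℂ) ∈ I := Ideal.Quotient.eq_zero_iff_mem.1 hx
    have := exists_O2_combination hu M
    rw [sup_eq_left.2 hle] at this
    exact Ideal.Quotient.eq_zero_iff_mem.2 this
  have hsurj : Function.Surjective φ := by
    intro y
    obtain ⟨a, rfl⟩ := Ideal.Quotient.mk_surjective y
    obtain ⟨b, hb⟩ := exists_O2_sub_mem_weightIdeal a M
    refine ⟨Ideal.Quotient.mk _ b, ?_⟩
    change Ideal.Quotient.mk I b = Ideal.Quotient.mk I a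
    rw [eq_comm, Ideal.Quotient.mk_eq_mk_iff_sub_mem]
    exact hM (weightIdeal_one_le_maxIdeal_pow M hb)
  have hfin := finite_quotient_of_maxIdeal_pow_le hM
  rw [intersectionNumber, (LinearEquiv.ofBijective φ ⟨hinj, hsurj⟩).rank_eq,
    ← Module.finrank_eq_rank, Cardinal.toENat_nat]

/-! ### Changes of coordinates. -/

theorem eq_zero_of_forall_mem_weightIdeal {w : Fin 2 → ℕ} {f : MvPowerSeries (Fin 2) ℂ}
    (h : ∀ N : ℕ, f ∈ weightIdeal w N) : f = 0 := by
  ext n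
  by_contra hn
  have := h (Finsupp.weight w n + 1) n hn
  push_cast at this
  omega

section Substitution

variable {a : Fin 2 → MvPowerSeries (Fin 2) ℂ}

theorem map_maxIdeal_le (ha : ∀ i, constantCoeff (a i) = 0) :
    maxIdeal.map (substAlgHom (R := ℂ) (hasSubst_of_constantCoeff_zero ha)) ≤ maxIdeal := by
  rw [maxIdeal, Ideal.map_span, Ideal.span_le]
  rintro _ ⟨_, ⟨i, rfl⟩, rfl⟩
  rw [SetLike.mem_coe, substAlgHom_X, eq_X_mul_divX_add (ha i)]
  exact add_mem (Ideal.mul_mem_right _ _ (Ideal.subset_span ⟨0, rfl⟩))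
    (Ideal.mul_mem_right _ _ (Ideal.subset_span ⟨1, rfl⟩))

theorem substAlgHom_mem_weightIdeal (ha : ∀ i, constantCoeff (a i) = 0) {N : ℕ}
    {f : MvPowerSeries (Fin 2) ℂ} (hf : f ∈ weightIdeal 1 N) :
    substAlgHom (R := ℂ) (hasSubst_of_constantCoeff_zero ha) f ∈ weightIdeal 1 N := by
  refine maxIdeal_pow_le_weightIdeal (fun _ => Nat.one_pos) N ?_
  have h := Ideal.mem_map_of_mem (substAlgHom (R := ℂ) (hasSubst_of_constantCoeff_zero ha))
    (weightIdeal_one_le_maxIdeal_pow N hf)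
  rw [Ideal.map_pow] at h
  exact Ideal.pow_right_mono (map_maxIdeal_le ha) N h

/-- The chain rule. -/
theorem pderiv_substAlgHom (ha : ∀ i, constantCoeff (a i) = 0) (i : Fin 2)
    (f : MvPowerSeries (Fin 2) ℂ) :
    pderiv ℂ i (substAlgHom (R := ℂ) (hasSubst_of_constantCoeff_zero ha) f) =
      substAlgHom (R := ℂ) (hasSubst_of_constantCoeff_zero ha) (pderiv ℂ 0 f) * pderiv ℂ i (a 0) +
      substAlgHom (R := ℂ) (hasSubst_of_constantCoeff_zero ha) (pderiv ℂ 1 f) *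
        pderiv ℂ i (a 1) := by
  set τ := substAlgHom (R := ℂ) (S := ℂ) (hasSubst_of_constantCoeff_zero ha) with hτ
  have hX : ∀ j, τ (X j) = a j := fun j => substAlgHom_X _ j
  let D : MvPowerSeries (Fin 2) ℂ →ₗ[ℂ] MvPowerSeries (Fin 2) ℂ :=
    (pderiv ℂ i).toLinearMap ∘ₗ τ.toLinearMap -
      (LinearMap.mulRight ℂ (pderiv ℂ i (a 0)) ∘ₗ τ.toLinearMap ∘ₗ (pderiv ℂ 0).toLinearMap +
      LinearMap.mulRight ℂ (pderiv ℂ i (a 1)) ∘ₗ τ.toLinearMap ∘ₗ (pderiv ℂ 1).toLinearMap)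
  have hD : ∀ f, D f = pderiv ℂ i (τ f) - (τ (pderiv ℂ 0 f) * pderiv ℂ i (a 0) +
    τ (pderiv ℂ 1 f) * pderiv ℂ i (a 1)) := fun f => rfl
  -- The defect D vanishes on polynomials by the product rule. It lowers order by at most one, so
  -- truncation at N + 1 shows that D f has order at least N for every N.
  have hpoly : ∀ p : MvPolynomial (Fin 2) ℂ, D p = 0 := by
    intro p
    induction p using MvPolynomial.induction_on with
    | C c =>
      have h : τ (C c) = C c := τ.commutes c
      rw [hD, MvPolynomial.coe_C, h]
      simp
    | add p q hp hq => rw [MvPolynomial.coe_add, map_add, hp, hq, add_zero]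
    | mul_X p j hp =>
      have hXj : D (X j) = 0 := by
        rw [hD, hX]
        fin_cases j <;> simp [pderiv_X_of_ne]
      rw [hD] at hp hXj ⊢
      rw [hX] at hXj
      rw [MvPolynomial.coe_mul, MvPolynomial.coe_X]
      simp only [map_mul, Derivation.leibniz, smul_eq_mul, map_add, hX]
      linear_combination (a j) * hp + τ (p : MvPowerSeries (Fin 2) ℂ) * hXj
  have hmem : ∀ N : ℕ, D f ∈ weightIdeal 1 N := by
    intro N
    obtain ⟨p, hp⟩ : ∃ p : MvPolynomial (Fin 2) ℂ,
        f - (p : MvPowerSeries (Fin 2) ℂ) ∈ weightIdeal 1 (N + 1 : ℕ) :=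
      ⟨truncTotal (N + 1) f, sub_truncTotal_mem_weightIdeal f (N + 1)⟩
    rw [← sub_add_cancel f (p : MvPowerSeries (Fin 2) ℂ), map_add, hpoly, add_zero, hD]
    have h1 : ∀ j, pderiv ℂ j (f - (p : MvPowerSeries (Fin 2) ℂ)) ∈ weightIdeal 1 N := by
      intro j
      simpa using pderiv_mem_weightIdeal j hp
    have h2 := weightIdeal_anti (by simp : (N : ℤ) ≤ _)
      (pderiv_mem_weightIdeal i (substAlgHom_mem_weightIdeal ha hp))
    refine sub_mem h2 (add_mem ?_ ?_) <;>
    exact Ideal.mul_mem_right _ _ (substAlgHom_mem_weightIdeal ha (h1 _))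
  have := eq_zero_of_forall_mem_weightIdeal hmem
  rw [hD] at this
  exact sub_eq_zero.1 this

/-- The inflection form of F is its second derivative along the tangent vector v = (F_y, −F_x). For
F = f ∘ a, the differential of a sends v to the Jacobian determinant times the tangent vector of f,
whence the squared factor. The second derivatives of a along v are quadratic in the first
derivatives of f and are multiplied by one more such derivative. -/
theorem exists_hessianForm_substAlgHom (ha : ∀ i, constantCoeff (a i) = 0)
    (f : MvPowerSeries (Fin 2) ℂ) :
    ∃ c : Fin 4 → MvPowerSeries (Fin 2) ℂ,
      hessianForm 0 1 (substAlgHom (R := ℂ) (hasSubst_of_constantCoeff_zero ha) f) =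
        (pderiv ℂ 0 (a 0) * pderiv ℂ 1 (a 1) - pderiv ℂ 1 (a 0) * pderiv ℂ 0 (a 1)) ^ 2 *
          substAlgHom (R := ℂ) (hasSubst_of_constantCoeff_zero ha) (hessianForm 0 1 f) +
        (c 0 * substAlgHom (R := ℂ) (hasSubst_of_constantCoeff_zero ha) (pderiv ℂ 1 f) ^ 3 +
        c 1 * substAlgHom (R := ℂ) (hasSubst_of_constantCoeff_zero ha) (pderiv ℂ 1 f) ^ 2 *
          substAlgHom (R := ℂ) (hasSubst_of_constantCoeff_zero ha) (pderiv ℂ 0 f) +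
        c 2 * substAlgHom (R := ℂ) (hasSubst_of_constantCoeff_zero ha) (pderiv ℂ 1 f) *
          substAlgHom (R := ℂ) (hasSubst_of_constantCoeff_zero ha) (pderiv ℂ 0 f) ^ 2 +
        c 3 * substAlgHom (R := ℂ) (hasSubst_of_constantCoeff_zero ha) (pderiv ℂ 0 f) ^ 3) := by
  set τ := substAlgHom (R := ℂ) (S := ℂ) (hasSubst_of_constantCoeff_zero ha) with hτ
  have hc := pderiv_substAlgHom ha
  rw [← hτ] at hc
  simp only [hessianForm, hc, map_add, Derivation.leibniz, smul_eq_mul, map_sub, map_mul, map_pow,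
    map_ofNat, pderiv_comm 0 1 f]
  generalize τ (pderiv ℂ 1 (pderiv ℂ 0 f)) = s
  generalize τ (pderiv ℂ 0 (pderiv ℂ 0 f)) = r
  generalize τ (pderiv ℂ 1 (pderiv ℂ 1 f)) = t
  generalize τ (pderiv ℂ 1 f) = q
  generalize τ (pderiv ℂ 0 f) = p
  generalize pderiv ℂ 0 (pderiv ℂ 0 (a 0)) = x00
  generalize pderiv ℂ 1 (pderiv ℂ 0 (a 0)) = x01
  generalize pderiv ℂ 1 (pderiv ℂ 1 (a 0)) = x11
  generalize pderiv ℂ 0 (pderiv ℂ 0 (a 1)) = y00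
  generalize pderiv ℂ 1 (pderiv ℂ 0 (a 1)) = y01
  generalize pderiv ℂ 1 (pderiv ℂ 1 (a 1)) = y11
  generalize pderiv ℂ 0 (a 0) = x0
  generalize pderiv ℂ 1 (a 0) = x1
  generalize pderiv ℂ 0 (a 1) = y0
  generalize pderiv ℂ 1 (a 1) = y1
  -- v is a combination of (y1, −y0) and (x1, −x0), with coefficients q = f_y∘a and p = f_x∘a; α, β,
  -- γ are the coefficients of q², pq, p² when a second derivative is evaluated on it.
  let α : MvPowerSeries (Fin 2) ℂ → MvPowerSeries (Fin 2) ℂ → MvPowerSeries (Fin 2) ℂ →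
    MvPowerSeries (Fin 2) ℂ := fun z00 z01 z11 => y1 ^ 2 * z00 - 2 * y0 * y1 * z01 + y0 ^ 2 * z11
  let β : MvPowerSeries (Fin 2) ℂ → MvPowerSeries (Fin 2) ℂ → MvPowerSeries (Fin 2) ℂ →
    MvPowerSeries (Fin 2) ℂ := fun z00 z01 z11 =>
      2 * (x1 * y1 * z00 - (x0 * y1 + x1 * y0) * z01 + x0 * y0 * z11)
  let γ : MvPowerSeries (Fin 2) ℂ → MvPowerSeries (Fin 2) ℂ → MvPowerSeries (Fin 2) ℂ →
    MvPowerSeries (Fin 2) ℂ := fun z00 z01 z11 => x1 ^ 2 * z00 - 2 * x0 * x1 * z01 + x0 ^ 2 * z11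
  refine ⟨![α y00 y01 y11, α x00 x01 x11 + β y00 y01 y11, β x00 x01 x11 + γ y00 y01 y11,
    γ x00 x01 x11], ?_⟩
  simp only [α, β, γ, Matrix.cons_val]
  ring

end Substitution

/-! ### Multiplication by units, and the effect of coordinate changes on dimensions. -/

/-- Modulo F the first derivatives of AF are A F_i, and the terms A_i F_j in its second derivatives
cancel along the tangent vector. -/
theorem dvd_hessianForm_mul_sub (i j : Fin 2) (A F : MvPowerSeries (Fin 2) ℂ) :
    F ∣ hessianForm i j (A * F) - A ^ 3 * hessianForm i j F := by
  rw [← Ideal.mem_span_singleton, ← Ideal.Quotient.eq_zero_iff_mem]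
  have hF : Ideal.Quotient.mk (Ideal.span {F}) F = 0 :=
    Ideal.Quotient.eq_zero_iff_mem.2 (Ideal.mem_span_singleton_self F)
  simp only [hessianForm, Derivation.leibniz, smul_eq_mul, map_add, map_sub, map_mul, map_pow,
    map_ofNat, hF]
  ring

theorem span_pair_hessianForm_mul (i j : Fin 2) {A : MvPowerSeries (Fin 2) ℂ} (hA : IsUnit A)
    (F : MvPowerSeries (Fin 2) ℂ) :
    Ideal.span {A * F, hessianForm i j (A * F)} = Ideal.span {F, hessianForm i j F} := by
  obtain ⟨c, hc⟩ := dvd_hessianForm_mul_sub i j A F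
  obtain ⟨B, hB⟩ := hA.exists_left_inv
  refine le_antisymm ?_ ?_ <;> rw [Ideal.span_le] <;> rintro x (hx | hx) <;> rw [hx]
  · exact Ideal.mem_span_pair.2 ⟨A, 0, by ring⟩
  · exact Ideal.mem_span_pair.2 ⟨c, A ^ 3, by linear_combination -hc⟩
  · exact Ideal.mem_span_pair.2 ⟨B, 0, by linear_combination F * hB⟩
  · exact Ideal.mem_span_pair.2 ⟨-(B ^ 4 * c), B ^ 3, by
      linear_combination B ^ 3 * hc + hessianForm i j F * (B ^ 2 * A ^ 2 + B * A + 1) * hB -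
        B ^ 3 * c * F * hB⟩

/-- A pair of mutually inverse formal changes of coordinates acts by an automorphism which takes
`hessianForm 0 1 (f ∘ ψ)`, up to a unit, to `hessianForm 0 1 f` plus a cubic form in the
derivatives of `f`. -/
theorem exists_finrank_quotient_hessianForm_subst {φ ψ : Fin 2 → MvPowerSeries (Fin 2) ℂ}
    (hφ : ∀ i, constantCoeff (φ i) = 0) (hψ : ∀ i, constantCoeff (ψ i) = 0)
    (hl : ∀ i, subst φ (ψ i) = X i) (hr : ∀ i, subst ψ (φ i) = X i)
    (f : MvPowerSeries (Fin 2) ℂ) :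
    ∃ (u : MvPowerSeries (Fin 2) ℂ) (c : Fin 4 → MvPowerSeries (Fin 2) ℂ), IsUnit u ∧
      ∀ H, H = u * hessianForm 0 1 f + (c 0 * pderiv ℂ 1 f ^ 3 +
          c 1 * pderiv ℂ 1 f ^ 2 * pderiv ℂ 0 f + c 2 * pderiv ℂ 1 f * pderiv ℂ 0 f ^ 2 +
          c 3 * pderiv ℂ 0 f ^ 3) →
        (∀ M, maxIdeal ^ M ≤ Ideal.span {f, H} →
          maxIdeal ^ M ≤ Ideal.span {subst ψ f, hessianForm 0 1 (subst ψ f)}) ∧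
        Module.finrank ℂ (MvPowerSeries (Fin 2) ℂ ⧸
            Ideal.span {subst ψ f, hessianForm 0 1 (subst ψ f)}) =
          Module.finrank ℂ (MvPowerSeries (Fin 2) ℂ ⧸ Ideal.span {f, H}) := by
  have hφs := hasSubst_of_constantCoeff_zero hφ
  have hψs := hasSubst_of_constantCoeff_zero hψ
  let σ := substAlgHom (R := ℂ) (S := ℂ) hφs
  let τ := substAlgHom (R := ℂ) (S := ℂ) hψs
  have hστ : ∀ x, σ (τ x) = x := by
    intro x
    change substAlgHom hφs (substAlgHom hψs x) = x
    rw [substAlgHom_apply, substAlgHom_apply, subst_comp_subst_apply hψs hφs]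
    simp only [hl]
    rw [subst_self, id]
  have hτσ : ∀ x, τ (σ x) = x := by
    intro x
    change substAlgHom hψs (substAlgHom hφs x) = x
    rw [substAlgHom_apply, substAlgHom_apply, subst_comp_subst_apply hφs hψs]
    simp only [hr]
    rw [subst_self, id]
  let E : MvPowerSeries (Fin 2) ℂ ≃ₐ[ℂ] MvPowerSeries (Fin 2) ℂ :=
    AlgEquiv.ofAlgHom τ σ (AlgHom.ext hτσ) (AlgHom.ext hστ)
  have hτf : subst ψ f = τ f := (substAlgHom_apply hψs f).symm
  obtain ⟨c, hc⟩ := exists_hessianForm_substAlgHom hψ f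
  set δ := pderiv ℂ 0 (ψ 0) * pderiv ℂ 1 (ψ 1) - pderiv ℂ 1 (ψ 0) * pderiv ℂ 0 (ψ 1) with hδ
  -- The chain rule for the composite ψ∘φ = id: the Jacobian matrices are mutually inverse, so the
  -- determinant δ is carried to a unit by σ.
  have hJ : ∀ i k, σ (pderiv ℂ 0 (ψ i)) * pderiv ℂ k (φ 0) +
      σ (pderiv ℂ 1 (ψ i)) * pderiv ℂ k (φ 1) = pderiv ℂ k (X i) := by
    intro i k
    rw [← hl i, ← substAlgHom_apply hφs, pderiv_substAlgHom hφ]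
  have hunit : IsUnit (σ δ) := by
    refine IsUnit.of_mul_eq_one
      (pderiv ℂ 0 (φ 0) * pderiv ℂ 1 (φ 1) - pderiv ℂ 1 (φ 0) * pderiv ℂ 0 (φ 1)) ?_
    have h00 := hJ 0 0
    have h01 := hJ 0 1
    have h10 := hJ 1 0
    have h11 := hJ 1 1
    rw [pderiv_X_self] at h00 h11
    rw [pderiv_X_of_ne (by decide)] at h01 h10
    rw [hδ, map_sub, map_mul, map_mul]
    generalize σ (pderiv ℂ 0 (ψ 0)) = a at *
    generalize σ (pderiv ℂ 1 (ψ 0)) = b at *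
    generalize σ (pderiv ℂ 0 (ψ 1)) = c at *
    generalize σ (pderiv ℂ 1 (ψ 1)) = d at *
    linear_combination (c * pderiv ℂ 1 (φ 0) + d * pderiv ℂ 1 (φ 1)) * h00 + h11 -
      (c * pderiv ℂ 0 (φ 0) + d * pderiv ℂ 0 (φ 1)) * h01
  refine ⟨σ δ ^ 2, fun i => σ (c i), hunit.pow 2, ?_⟩
  rintro H rfl
  have hmap : ∀ x y, (Ideal.span {x, y}).map (E : MvPowerSeries (Fin 2) ℂ →+* MvPowerSeries (Fin 2) ℂ) = Ideal.span {τ x, τ y} := by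
    intro x y
    rw [Ideal.map_span, Set.image_pair]
    rfl
  have hspan : Ideal.span {subst ψ f, hessianForm 0 1 (subst ψ f)} = (Ideal.span {f, σ δ ^ 2 *
      hessianForm 0 1 f + (σ (c 0) * pderiv ℂ 1 f ^ 3 +
          σ (c 1) * pderiv ℂ 1 f ^ 2 * pderiv ℂ 0 f + σ (c 2) * pderiv ℂ 1 f * pderiv ℂ 0 f ^ 2 +
          σ (c 3) * pderiv ℂ 0 f ^ 3)}).map (E : MvPowerSeries (Fin 2) ℂ →+* MvPowerSeries (Fin 2) ℂ) := by
    rw [hmap, hτf, hc]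
    simp only [map_add, map_mul, map_pow, hτσ]
    rfl
  constructor
  · intro M hM
    rw [hspan]
    refine le_trans ?_ (Ideal.map_mono hM)
    rw [Ideal.map_pow]
    refine Ideal.pow_right_mono ?_ M
    intro x hx
    have h1 := map_maxIdeal_le hφ (Ideal.mem_map_of_mem (substAlgHom (R := ℂ) hφs) hx)
    have h2 := Ideal.mem_map_of_mem (E : MvPowerSeries (Fin 2) ℂ →+* MvPowerSeries (Fin 2) ℂ) h1
    have h3 : (E : MvPowerSeries (Fin 2) ℂ →+* MvPowerSeries (Fin 2) ℂ) (substAlgHom (R := ℂ) hφs x) = x := hτσ x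
    rwa [h3] at h2
  · exact ((Ideal.quotientEquivAlg _ _ E hspan).toLinearEquiv.finrank_eq).symm

/-! ### Initial forms after the cubic correction. -/

theorem hasInitialForm_C_constantCoeff {w : Fin 2 → ℕ} (hw : ∀ i, 0 < w i)
    (u : MvPowerSeries (Fin 2) ℂ) : HasInitialForm w 0 u (C (constantCoeff u)) := by
  refine ⟨IsWeightForm.const _, fun n hn => ?_⟩
  have hn0 : n ≠ 0 := by
    rintro rfl
    simp at hn
  by_contra hlt
  refine hn0 ?_
  rw [weight_fin_two w n zero_ne_one] at hlt
  have h0 := Nat.le_mul_of_pos_right (n 0) (hw 0)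
  have h1 := Nat.le_mul_of_pos_right (n 1) (hw 1)
  push_cast at hlt
  zify at h0 h1
  ext i
  fin_cases i
  · simp only [Fin.zero_eta, Finsupp.coe_zero, Pi.zero_apply]; omega
  · simp only [Fin.mk_one, Finsupp.coe_zero, Pi.zero_apply]; omega

/-- If the restriction of `c` to the `x_i`-axis has order `m` there, then `c` has an initial form
`γ x_i ^ m`, provided that `x_j` has greater weight; or `c` has order greater than `s`. -/
theorem mem_weightIdeal_or_exists_hasInitialForm {w : Fin 2 → ℕ} (hw : ∀ i, 0 < w i) {i j : Fin 2}
    (hij : i ≠ j) {s : ℤ} (hs : s < w j) (hsi : ∀ m : ℕ, (m : ℤ) * w i ≠ s)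
    (c : MvPowerSeries (Fin 2) ℂ) :
    c ∈ weightIdeal w (s + 1) ∨ ∃ (m : ℕ) (γ : ℂ), γ ≠ 0 ∧ (m : ℤ) * w i < s ∧
      HasInitialForm w (m * w i) c (C γ * X i ^ m) := by
  classical
  have hnj : ∀ n : Fin 2 →₀ ℕ, n j = 0 → n = Finsupp.single i (n i) := by
    intro n hn
    ext l
    by_cases hl : l = i
    · rw [hl, Finsupp.single_eq_same]
    · have : l = j := by omega
      rw [this, hn, Finsupp.single_eq_of_ne hij.symm]
  have hwt : ∀ n : Fin 2 →₀ ℕ, n j ≠ 0 → (w j : ℤ) ≤ (Finsupp.weight w n : ℕ) := by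
    intro n hn
    rw [weight_fin_two w n hij]
    have : w j ≤ n j * w j := Nat.le_mul_of_pos_left _ (Nat.pos_of_ne_zero hn)
    push_cast
    zify at this
    have : (0 : ℤ) ≤ n i * w i := by positivity
    omega
  have hwt0 : ∀ n : Fin 2 →₀ ℕ, n j = 0 → ((Finsupp.weight w n : ℕ) : ℤ) = n i * w i := by
    intro n hn
    rw [weight_fin_two w n hij, hn]
    simp
  -- A monomial containing x_j has weight above s, so only pure powers of x_i matter; `hsi` excludes
  -- one of weight exactly s.
  by_cases H : ∃ m : ℕ, (m : ℤ) * w i < s ∧ coeff (Finsupp.single i m) c ≠ 0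
  · right
    have hm := Nat.find_spec H
    have hmin := fun m' => Nat.find_min H (m := m')
    set m := Nat.find H with hmdef
    refine ⟨m, coeff (Finsupp.single i m) c, hm.2, hm.1, ?_, ?_⟩
    · simpa using (IsWeightForm.const (w := w) (coeff (Finsupp.single i m) c)).mul
        ((IsWeightForm.var i).pow m)
    · intro n hn
      rw [map_sub, coeff_C_mul, coeff_X_pow] at hn
      by_cases hj : n j = 0
      · rw [hwt0 n hj]
        have hni := hnj n hj
        have hlt : m < n i := by
          by_contra hle
          rcases (not_lt.1 hle).lt_or_eq with h | h
          · have hne : n ≠ Finsupp.single i m := by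
              intro h'
              rw [h', Finsupp.single_eq_same] at h
              exact lt_irrefl _ h
            rw [if_neg hne, mul_zero, sub_zero, hni] at hn
            refine hmin _ h ⟨lt_trans ?_ hm.1, hn⟩
            exact mul_lt_mul_of_pos_right (by exact_mod_cast h) (by exact_mod_cast hw i)
          · rw [h] at hni
            rw [if_pos hni, mul_one, ← hni, sub_self] at hn
            exact hn rfl
        have h1 : m * w i < n i * w i := Nat.mul_lt_mul_of_pos_right hlt (hw i)
        exact_mod_cast h1
      · have := hwt n hj
        have := hm.1
        omega
  · left
    push Not at H
    intro n hn
    by_cases hj : n j = 0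
    · rw [hwt0 n hj]
      have hni := hnj n hj
      rw [hni] at hn
      have h1 := hsi (n i)
      have h2 : ¬ ((n i : ℤ) * w i < s) := fun h => hn (H _ h)
      omega
    · have := hwt n hj
      omega

/-- As w_i < w_j, every cubic term containing f_i has weight above that of i_f. The term f_j³ has
weight 2w_i − w_j relative to it, so the outcome depends on how the order of c₀ compares with w_j −
2w_i. -/
theorem HasInitialForm.finrank_quotient_add_cubic_le {w : Fin 2 → ℕ} (hw : ∀ i, 0 < w i)
    (hc : Nat.Coprime (w 0) (w 1)) {k : ℕ} {f g : MvPowerSeries (Fin 2) ℂ}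
    (hf : HasInitialForm w (k * (w 0 * w 1) : ℕ) f g) (hg : g ≠ 0) {i j : Fin 2} (hij : i ≠ j)
    (hlt : w i < w j) (hdvd : ¬ w i ∣ w j) (hX : ¬ X i ∣ g)
    (hrj : IsRegularMod g (MvPowerSeries.pderiv ℂ j g))
    (hrh : IsRegularMod g (PlaneGerm.hessianForm i j g)) {u : MvPowerSeries (Fin 2) ℂ}
    (hu : IsUnit u) (c₀ c₁ c₂ c₃ : MvPowerSeries (Fin 2) ℂ) {H : MvPowerSeries (Fin 2) ℂ}
    (hH : H = u * PlaneGerm.hessianForm i j f +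
      (c₀ * MvPowerSeries.pderiv ℂ j f ^ 3 +
        c₁ * MvPowerSeries.pderiv ℂ j f ^ 2 * MvPowerSeries.pderiv ℂ i f +
        c₂ * MvPowerSeries.pderiv ℂ j f * MvPowerSeries.pderiv ℂ i f ^ 2 +
        c₃ * MvPowerSeries.pderiv ℂ i f ^ 3)) :
    (∃ M, maxIdeal ^ M ≤ Ideal.span {f, H}) ∧
      (Module.finrank ℂ (MvPowerSeries (Fin 2) ℂ ⧸ Ideal.span {f, H}) : ℤ) ≤
        k * (3 * (k * (w 0 * w 1) : ℕ) - 2 * w i - 2 * w j) := by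
  set d : ℤ := ((k * (w 0 * w 1) : ℕ) : ℤ) with hd
  have hu0 : constantCoeff u ≠ 0 := (isUnit_iff_constantCoeff.1 hu).ne_zero
  have hwi : (0 : ℤ) < w i := by exact_mod_cast hw i
  have hlt' : (w i : ℤ) < w j := by exact_mod_cast hlt
  have hpi := hf.pderiv i
  have hpj := hf.pderiv j
  have hmain : HasInitialForm w (3 * d - 2 * w i - 2 * w j) (u * PlaneGerm.hessianForm i j f)
      (C (constantCoeff u) * PlaneGerm.hessianForm i j g) := by
    simpa using (hasInitialForm_C_constantCoeff hw u).mul (hf.hessianForm i j)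
  have h1 : c₁ * MvPowerSeries.pderiv ℂ j f ^ 2 * MvPowerSeries.pderiv ℂ i f ∈
      weightIdeal w (3 * d - 2 * w i - 2 * w j + 1) := by
    rw [mul_assoc]
    refine Ideal.mul_mem_left _ _ (weightIdeal_anti ?_ ((hpj.pow 2).mul hpi).mem)
    push_cast
    omega
  have h2 : c₂ * MvPowerSeries.pderiv ℂ j f * MvPowerSeries.pderiv ℂ i f ^ 2 ∈
      weightIdeal w (3 * d - 2 * w i - 2 * w j + 1) := by
    rw [mul_assoc]
    refine Ideal.mul_mem_left _ _ (weightIdeal_anti ?_ (hpj.mul (hpi.pow 2)).mem)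
    push_cast
    omega
  have h3 : c₃ * MvPowerSeries.pderiv ℂ i f ^ 3 ∈
      weightIdeal w (3 * d - 2 * w i - 2 * w j + 1) := by
    refine Ideal.mul_mem_left _ _ (weightIdeal_anti ?_ (hpi.pow 3).mem)
    push_cast
    omega
  have hH' : H = u * PlaneGerm.hessianForm i j f + c₀ * MvPowerSeries.pderiv ℂ j f ^ 3 +
      (c₁ * MvPowerSeries.pderiv ℂ j f ^ 2 * MvPowerSeries.pderiv ℂ i f +
      c₂ * MvPowerSeries.pderiv ℂ j f * MvPowerSeries.pderiv ℂ i f ^ 2 +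
      c₃ * MvPowerSeries.pderiv ℂ i f ^ 3) := by rw [hH]; ring
  have h123 := add_mem (add_mem h1 h2) h3
  -- Non-divisibility excludes a tie, in which the initial forms of u i_f and c₀ f_j³ could cancel.
  have hsi : ∀ m : ℕ, (m : ℤ) * w i ≠ w j - 2 * w i := by
    intro m hm
    refine hdvd ⟨m + 2, ?_⟩
    zify
    linarith
  rcases mem_weightIdeal_or_exists_hasInitialForm hw hij (s := (w j : ℤ) - 2 * w i) (by omega) hsi
    c₀ with h0 | ⟨m, γ, hγ, hm, h0⟩
  · have h4 : c₀ * MvPowerSeries.pderiv ℂ j f ^ 3 ∈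
        weightIdeal w (3 * d - 2 * w i - 2 * w j + 1) := by
      refine weightIdeal_anti ?_ (mul_mem_weightIdeal h0 (hpj.pow 3).mem)
      push_cast
      omega
    have hHi := (hmain.add_mem_weightIdeal h4).add_mem_weightIdeal h123
    rw [← hH'] at hHi
    obtain ⟨hM, hD⟩ := hf.finrank_quotient_span_pair hw hc hHi hg
      ((IsRegularMod.of_isUnit (isUnit_C hu0)).mul hrh)
    exact ⟨hM, hD.le⟩
  -- Here γ x_i^m g_j³ is the initial form of H. It is regular modulo g and of smaller weight than
  -- i_g, so Bézout gives a smaller number.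
  · have h4 := h0.mul (hpj.pow 3)
    have hle : (m : ℤ) * w i + (3 : ℕ) * (d - w j) + 1 ≤ 3 * d - 2 * w i - 2 * w j := by
      push_cast
      omega
    have hHi := (h4.add_mem_weightIdeal (weightIdeal_anti hle hmain.mem)).add_mem_weightIdeal
      (weightIdeal_anti (by omega) h123)
    rw [add_comm (c₀ * _), ← hH'] at hHi
    obtain ⟨hM, hD⟩ := hf.finrank_quotient_span_pair hw hc hHi hg
      (((IsRegularMod.of_isUnit (isUnit_C hγ)).mul ((isRegularMod_X hX).pow m)).mul (hrj.pow 3))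
    refine ⟨hM, hD.le.trans ?_⟩
    exact mul_le_mul_of_nonneg_left (by omega) (Int.natCast_nonneg k)

/-! ### Consequences of semi-quasihomogeneity, and the conclusion. -/

theorem exists_coeff_ne_zero_of_not_X_dvd {i : Fin 2} {g : MvPolynomial (Fin 2) ℂ}
    (h : ¬ MvPolynomial.X i ∣ g) : ∃ n : Fin 2 →₀ ℕ, n i = 0 ∧ MvPolynomial.coeff n g ≠ 0 := by
  by_contra hn
  push Not at hn
  refine h (MvPolynomial.X_dvd_iff_modMonomial_eq_zero.2 ?_)
  ext n
  by_cases hi : Finsupp.single i 1 ≤ n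
  · rw [MvPolynomial.coeff_modMonomial_of_le _ hi, MvPolynomial.coeff_zero]
  · rw [MvPolynomial.coeff_modMonomial_of_not_le _ hi, MvPolynomial.coeff_zero]
    refine hn n ?_
    by_contra h0
    exact hi (by simpa using Nat.one_le_iff_ne_zero.2 h0)

/-- The consequences of semi-quasihomogeneity that are used below. -/
theorem IsSemiQuasihomogeneous.exists_hasInitialForm {w : Fin 2 → ℕ} {d : ℕ}
    {g : MvPolynomial (Fin 2) ℂ} {f : O2} (hfg : IsSemiQuasihomogeneous w d g f)
    (hg : ¬ ∃ n : ℕ, g.IsHomogeneous n) (hXg : ∀ i, ¬ MvPolynomial.X i ∣ g) :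
    ∃ (k : ℕ) (G : MvPowerSeries (Fin 2) ℂ), d = k * (w 0 * w 1) ∧ w 0 ≠ w 1 ∧ G ≠ 0 ∧
      HasInitialForm w (k * (w 0 * w 1) : ℕ) (f : MvPowerSeries (Fin 2) ℂ) G ∧
      (∀ i, ¬ X i ∣ G) ∧ (∀ i j, i ≠ j → IsRegularMod G (pderiv ℂ j G)) ∧
      ∀ i j, i ≠ j → IsRegularMod G (hessianForm i j G) := by
  have hw := hfg.weight_pos
  have hc := hfg.coprime
  set G : MvPowerSeries (Fin 2) ℂ := (g : MvPowerSeries (Fin 2) ℂ) with hG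
  have hX : ∀ i, ¬ X i ∣ G := by
    intro i hdvd
    obtain ⟨n, hn, hne⟩ := exists_coeff_ne_zero_of_not_X_dvd (hXg i)
    refine hne ?_
    rw [← MvPolynomial.coeff_coe]
    exact X_dvd_iff.1 hdvd n hn
  have hG0 : G ≠ 0 := fun h => hX 0 (h ▸ dvd_zero _)
  -- Since x_j does not divide g, a pure power of x_i occurs in g, and its weight is d.
  have hdvd : ∀ i, w i ∣ d := by
    intro i
    obtain ⟨j, hij⟩ : ∃ j, i ≠ j := ⟨1 - i, by fin_cases i <;> decide⟩
    obtain ⟨n, hn, hne⟩ := exists_coeff_ne_zero_of_not_X_dvd (hXg j)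
    have h := hfg.quasihomogeneous hne
    rw [weight_fin_two w n hij, hn, zero_mul, add_zero] at h
    exact ⟨n i, by rw [← h, mul_comm]⟩
  obtain ⟨k, hk⟩ : ∃ k, d = k * (w 0 * w 1) := by
    obtain ⟨k, hk⟩ := hc.mul_dvd_of_dvd_of_dvd (hdvd 0) (hdvd 1)
    exact ⟨k, by rw [hk, mul_comm]⟩
  -- Equal coprime weights are both 1, which would make g homogeneous.
  have hne : w 0 ≠ w 1 := by
    intro h
    have h1 : w 1 = 1 := by rwa [h, Nat.coprime_self] at hc
    have hw1 : w = 1 := by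
      ext i
      fin_cases i
      · exact h.trans h1
      · exact h1
    refine hg ⟨d, ?_⟩
    have := hfg.quasihomogeneous
    rwa [hw1] at this
  have hform : IsWeightForm w d G := by
    intro n hn
    rw [hG, MvPolynomial.coeff_coe] at hn
    exact congrArg (Nat.cast : ℕ → ℤ) (hfg.quasihomogeneous hn)
  have hinit : HasInitialForm w d (f : MvPowerSeries (Fin 2) ℂ) G := by
    refine ⟨hform, fun n hn => ?_⟩
    have h : d < Finsupp.weight w n := hfg.higher_weight n hn
    omega
  have hmil : ∀ i, ∃ N, (X i : MvPowerSeries (Fin 2) ℂ) ^ N ∈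
      Ideal.span {pderiv ℂ 0 G, pderiv ℂ 1 G} :=
    exists_X_pow_mem_span_of_intersectionNumber_ne_top (f := pd 0 (ofPoly g))
      (h := pd 1 (ofPoly g)) hfg.nondegenerate
  have hreg : ∀ i j, i ≠ j → IsRegularMod G (pderiv ℂ j G) := by
    intro i j hij
    refine hform.isRegularMod_pderiv hij (hw i).ne' (hX i) ?_
    have h := hmil i
    fin_cases i <;> fin_cases j
    · exact absurd rfl hij
    · exact h
    · rw [Set.pair_comm]
      exact h
    · exact absurd rfl hij
  have hhess : ∀ i j, i ≠ j → IsRegularMod G (hessianForm i j G) := by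
    intro i j hij
    refine hform.isRegularMod_hessianForm hij (hw j).ne' ?_ (hX j) (hreg i j hij)
    fin_cases i <;> fin_cases j
    · exact absurd rfl hij
    · exact hne
    · exact hne.symm
    · exact absurd rfl hij
  exact ⟨k, G, hk, hne, hG0, hk ▸ hinit, hX, hreg, hhess⟩

theorem inflectionNumber_eq_finrank {f : O2} {M : ℕ} (hM : maxIdeal ^ M ≤
    Ideal.span {(f : MvPowerSeries (Fin 2) ℂ), hessianForm 0 1 (f : MvPowerSeries (Fin 2) ℂ)}) :
    inflectionNumber f = (Module.finrank ℂ (MvPowerSeries (Fin 2) ℂ ⧸ Ideal.span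
      {(f : MvPowerSeries (Fin 2) ℂ), hessianForm 0 1 (f : MvPowerSeries (Fin 2) ℂ)}) : ℕ) :=
  intersectionNumber_eq_finrank (f := f) (h := inflectionGerm f) hM

theorem KEquivalent.refl (f : O2) : KEquivalent f f := by
  refine ⟨fun i => ofPoly (MvPolynomial.X i), fun i => ofPoly (MvPolynomial.X i), 1, ?_, ?_⟩
  · constructor <;> intro i <;> simp only [coe_ofPoly_X, constantCoeff_X] <;>
    exact subst_X HasSubst.X i
  · simp only [coe_ofPoly_X]
    change (f : MvPowerSeries (Fin 2) ℂ) = 1 * subst X (f : MvPowerSeries (Fin 2) ℂ)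
    rw [subst_self, id, one_mul]

theorem HasInitialForm.finrank_quotient_le_of_kEquivalent {w : Fin 2 → ℕ} (hw : ∀ i, 0 < w i)
    (hc : Nat.Coprime (w 0) (w 1)) (hwne : ∀ i, w i ≠ 1) (hne : w 0 ≠ w 1) {k : ℕ} {f : O2}
    {G : MvPowerSeries (Fin 2) ℂ} (hG0 : G ≠ 0)
    (hinit' : HasInitialForm w (k * (w 0 * w 1) : ℕ) (f : MvPowerSeries (Fin 2) ℂ) G)
    (hX : ∀ i, ¬ MvPowerSeries.X i ∣ G)
    (hreg : ∀ i j, i ≠ j → IsRegularMod G (MvPowerSeries.pderiv ℂ j G))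
    (hhess : ∀ i j, i ≠ j → IsRegularMod G (PlaneGerm.hessianForm i j G)) {h : O2}
    (hfh : KEquivalent f h) :
    ∃ N : ℕ, inflectionNumber h = N ∧
      (N : ℤ) ≤ k * (3 * (k * (w 0 * w 1) : ℕ) - 2 * w 0 - 2 * w 1) := by
  obtain ⟨φ, ψ, A, hφψ, hh⟩ := hfh
  set F : MvPowerSeries (Fin 2) ℂ := (f : MvPowerSeries (Fin 2) ℂ) with hF
  obtain ⟨u, c, hu, hc'⟩ := exists_finrank_quotient_hessianForm_subst hφψ.zero_left
    hφψ.zero_right hφψ.left_inv hφψ.right_inv F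
  have hndvd : ∀ i j, i ≠ j → ¬ w i ∣ w j := by
    have hcop : ∀ i j, i ≠ j → Nat.Coprime (w i) (w j) := by
      intro i j hij
      fin_cases i <;> fin_cases j
      · exact absurd rfl hij
      · exact hc
      · exact hc.symm
      · exact absurd rfl hij
    intro i j hij hd
    exact hwne i ((hcop i j hij).eq_one_of_dvd hd)
  set H := u * PlaneGerm.hessianForm 0 1 F + (c 0 * MvPowerSeries.pderiv ℂ 1 F ^ 3 +
    c 1 * MvPowerSeries.pderiv ℂ 1 F ^ 2 * MvPowerSeries.pderiv ℂ 0 F + c 2 * MvPowerSeries.pderiv ℂ 1 F * MvPowerSeries.pderiv ℂ 0 F ^ 2 +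
    c 3 * MvPowerSeries.pderiv ℂ 0 F ^ 3) with hH
  obtain ⟨hc1, hc2⟩ := hc' H rfl
  have key : (∃ M, maxIdeal ^ M ≤ Ideal.span {F, H}) ∧
      (Module.finrank ℂ (MvPowerSeries (Fin 2) ℂ ⧸ Ideal.span {F, H}) : ℤ) ≤
        k * (3 * (k * (w 0 * w 1) : ℕ) - 2 * w 0 - 2 * w 1) := by
    rcases hne.lt_or_gt with hlt | hlt
    · exact hinit'.finrank_quotient_add_cubic_le hw hc hG0 zero_ne_one hlt
        (hndvd 0 1 zero_ne_one) (hX 0) (hreg 0 1 zero_ne_one) (hhess 0 1 zero_ne_one) hu _ _ _ _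
        hH
    -- The variables exchange roles, so the coefficients of the cubic form are read in reverse
    -- order.
    · rw [sub_right_comm]
      refine hinit'.finrank_quotient_add_cubic_le hw hc hG0 one_ne_zero hlt
        (hndvd 1 0 one_ne_zero) (hX 1) (hreg 1 0 one_ne_zero) (hhess 1 0 one_ne_zero) hu
        (c 3) (c 2) (c 1) (c 0) ?_
      rw [hH, hessianForm_symm 0 1]
      ring
  obtain ⟨⟨M', hM'⟩, hle⟩ := key
  have hA : IsUnit ((A : O2) : MvPowerSeries (Fin 2) ℂ) := A.isUnit.map O2.val
  have hspan := span_pair_hessianForm_mul 0 1 hA (subst (fun j => (ψ j).1) F)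
  rw [← hh] at hspan
  refine ⟨_, inflectionNumber_eq_finrank (M := M') ?_, ?_⟩
  · rw [hspan]
    exact hc1 M' hM'
  · rw [hspan, hc2]
    exact hle

end PlaneGerm

theorem mainTheorem9 (w : Fin 2 → ℕ) (d : ℕ) (g : MvPolynomial (Fin 2) ℂ) (f : PlaneGerm.O2)
    (hf0 : MvPowerSeries.constantCoeff (f : MvPowerSeries (Fin 2) ℂ) = 0)
    (hfg : PlaneGerm.IsSemiQuasihomogeneous w d g f)
    (hg : ¬ ∃ n : ℕ, g.IsHomogeneous n)
    (hx : ¬ MvPolynomial.X 0 ∣ g) (hy : ¬ MvPolynomial.X 1 ∣ g) :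
    (∃ N : ℕ, PlaneGerm.inflectionNumber f = (N : ℕ∞) ∧
      (N : ℚ) = (d : ℚ) * (3 * (d : ℚ) - 2 * (w 0 : ℚ) - 2 * (w 1 : ℚ)) /
        ((w 0 : ℚ) * (w 1 : ℚ))) ∧
    (w 0 ≠ 1 → w 1 ≠ 1 →
      IsGreatest {k : ℕ∞ | ∃ h : PlaneGerm.O2, PlaneGerm.KEquivalent f h ∧
        k = PlaneGerm.inflectionNumber h} (PlaneGerm.inflectionNumber f)) := by
  have hw := hfg.weight_pos
  have hc := hfg.coprime
  obtain ⟨k, G, hk, hne, hG0, hinit, hX, hreg, hhess⟩ :=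
    hfg.exists_hasInitialForm hg (Fin.forall_fin_two.2 ⟨hx, hy⟩)
  obtain ⟨⟨M, hM⟩, hD⟩ := hinit.finrank_quotient_span_pair hw hc (hinit.hessianForm 0 1) hG0
    (hhess 0 1 zero_ne_one)
  have hI := PlaneGerm.inflectionNumber_eq_finrank hM
  refine ⟨⟨_, hI, ?_⟩, fun hw0 hw1 => ⟨⟨f, PlaneGerm.KEquivalent.refl f, rfl⟩, ?_⟩⟩
  · have hD' := congrArg (Int.cast : ℤ → ℚ) hD
    push_cast at hD'
    have h0 : (w 0 : ℚ) ≠ 0 := by exact_mod_cast (hw 0).ne'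
    have h1 : (w 1 : ℚ) ≠ 0 := by exact_mod_cast (hw 1).ne'
    rw [hD', hk]
    push_cast
    field_simp
  · rintro _ ⟨h, hfh, rfl⟩
    obtain ⟨N, hN, hle⟩ := hinit.finrank_quotient_le_of_kEquivalent hw hc
      (Fin.forall_fin_two.2 ⟨hw0, hw1⟩) hne hG0 hX hreg hhess hfh
    rw [hN, hI, Nat.cast_le]
    zify
    rw [hD]
    exact hle
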